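/- **Setting.** Let $\dot{\mathbb C}=\mathbb C\cup\{\infty\}$, let $a_1,\dots,a_m\in\mathbb C$ be distinct points lying in this order on a smooth simple closed positively oriented curve $\Gamma\subset\mathbb C$ which divides $\dot{\mathbb C}$ into two domains, $D_+$ (to the left of $\Gamma$) and $D_-\ni\infty$. Let $S=\dot{\mathbb C}\setminus\{a_1,\dots,a_m\}$, let $\rho:\tilde S\to S$ be its universal covering, and $\tilde S^*=\tilde S\setminus\rho^{-1}(\infty)$. Fix $\tilde z_0\in\tilde S$ with $\rho(\tilde z_0)\in D_+$. For $k=1,\dots,m$ let $\sigma_k$ be the deck transformation for which there is a path in $\tilde S$ from $\tilde z_0$ to $\sigma_k(\tilde z_0)$ whose projection starts in $D_+$, crosses into $D_-$ through the open subarc of $\Gamma$ from $a_{k-1}$ to $a_k$, returns to $D_+$ through the open subarc from $a_k$ to $a_{k+1}$ (cyclic indices), and does not meet $\Gamma$ otherwise. A *solution* of a system $Y'=A(z)Y$ means an analytic solution with values in the group $G\mathbb C^{n\times n}$ of invertible complex $n\times n$ matrices. *Admissible data* are $n\times n$ matrices $[M_1,\dots,M_m]$, $[E_1,\dots,E_m]$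 such that $M_1\cdots M_m=I$, $M_k$ is similar to $\exp(-2\pi iE_k)$, and no two eigenvalues of $E_k$ differ by a nonzero integer. The system $Y'=A(z)Y$ is *of standard form* with these data, with singularities $a_1,\dots,a_m$ and with indices $\varkappa_1\ge\dots\ge\varkappa_n$ in $\mathbb Z$, if 1. $A$ is analytic on $\mathbb C\setminus\{a_1,\dots,a_m\}$ and the singularity at $\infty$ is (at most) apparent, so that the solutions are analytic functions $Y:\tilde S^*\to G\mathbb C^{n\times n}$; 2. for a solution $Y$, if $Y(\tilde z)=Y(\sigma_k(\tilde z))\chi(\sigma_k)$, then there is $C\in G\mathbb C^{n\times n}$ with $M_k=C^{-1}\chi(\sigma_k)C$ for all $k$; 3. for each $k$, the solutions on the universal covering of a small punctured disk around $a_k$ are of the form $Z_k(z)\exp(E_k\ln(\tilde z-a_k))C$ with $Z_k$ analytic and invertible on the disk, including $a_k$, and $C\in G\mathbb C^{n\times n}$; 4. the solutions on some $\{R<|z|<\infty\}$ are of the form $\operatorname{diag}(z^{\varkappa_1},\dots,z^{\varkappa_n})Z_\infty(z)C$ with $Z_\infty$ analytic and invertible there and at $\infty$, and $C\in G\mathbb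 C^{n\times n}$. **Theorem.** Let $Y_1'=A_1(z)Y_1$ and $Y_2'=A_2(z)Y_2$ be two systems of standard form with the same admissible data and the same singularities $a_1,\dots,a_m$. Then their indices coincide. Moreover, let the indices be $\bar\varkappa_1>\dots>\bar\varkappa_k$, where $\bar\varkappa_j$ occurs exactly $l_j\ge1$ times and $l_1+\dots+l_k=n$. Then there is a matrix polynomial $V:\mathbb C\to G\mathbb C^{n\times n}$ of block form $V(z)=(V_{ij}(z))_{i,j=1}^k$, with $V_{ij}(z)$ of size $l_i\times l_j$, $V_{ij}=0$ for $i>j$, $V_{jj}\in G\mathbb C^{l_j\times l_j}$ constant, and $V_{ij}(z)$ of degree at most $\bar\varkappa_i-\bar\varkappa_j$ for $i<j$, such that $$A_2(z)=V'(z)V(z)^{-1}+V(z)A_1(z)V(z)^{-1},\qquad z\in\mathbb C\setminus\{a_1,\dots,a_m\},\tag{1}$$ and such that $$\text{for all solutions } Y_1,Y_2 \text{ of the two systems there is } C\in G\mathbb C^{n\times n} \text{ with } Y_2(\tilde z)=V(z)Y_1(\tilde z)C,\quad \tilde z\in\tilde S^*,\ z=\rho(\tilde z).\tag{2}$$ For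 every $V$ of this block form, (1) and (2) are equivalent. -/

import Mathlib

open Set Filter Topology
open scoped OnePoint

noncomputable section

/-- A smooth (regular, `C¹`) simple closed curve `Γ` in the plane, positively oriented, which
divides the Riemann sphere into two domains `inner` (called `D₊`) and `outer` (called `D₋`, the
one that contains `∞`). Positive orientation: `D₊` lies to the left of `Γ` and `D₋` to the
right. -/
structure PositiveClosedCurve where
  /-- a parametrization of period one -/
  γ : ℝ → ℂ
  contDiff : ContDiff ℝ 1 γ
  periodic : Function.Periodic γ 1
  deriv_ne_zero : ∀ t, deriv γ t ≠ 0
  injOn : InjOn γ (Ico 0 1)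
  /-- the domain `D₊` -/
  inner : Set (OnePoint ℂ)
  /-- the domain `D₋` -/
  outer : Set (OnePoint ℂ)
  isOpen_inner : IsOpen inner
  isOpen_outer : IsOpen outer
  isConnected_inner : IsConnected inner
  isConnected_outer : IsConnected outer
  disjoint : Disjoint inner outer
  union_eq : inner ∪ outer = (range fun t : ℝ => (γ t : OnePoint ℂ))ᶜ
  infty_mem : ∞ ∈ outer
  positive : ∀ t, ∀ᶠ ε : ℝ in 𝓝[>] 0,
    ((γ t + ε * Complex.I * deriv γ t : ℂ) : OnePoint ℂ) ∈ inner ∧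
      ((γ t - ε * Complex.I * deriv γ t : ℂ) : OnePoint ℂ) ∈ outer

namespace PositiveClosedCurve

variable {m : ℕ}

/-- The points `a₁, …, aₘ` lie on `Γ` in this order and are distinct: along the parametrization
they are met at times `t₁ < … < tₘ` within one period. -/
def PassesInOrder (Γ : PositiveClosedCurve) (a : Fin m → ℂ) : Prop :=
  ∃ t : Fin m → ℝ, StrictMono t ∧ (∀ i j, t i < t j + 1) ∧ ∀ k, Γ.γ (t k) = a k

/-- The open subarc of `Γ` which ends at `aₖ`, i.e. the one joining `aₖ₋₁` to `aₖ`
(indices are cyclic). -/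
def arcBefore (Γ : PositiveClosedCurve) (a : Fin m → ℂ) (k : Fin m) : Set (OnePoint ℂ) :=
  {p | ∃ s u : ℝ, p = (Γ.γ s : OnePoint ℂ) ∧ s < u ∧ Γ.γ u = a k ∧
    ∀ v ∈ Ico s u, ∀ j, Γ.γ v ≠ a j}

/-- The open subarc of `Γ` which starts at `aₖ`, i.e. the one joining `aₖ` to `aₖ₊₁`
(indices are cyclic). -/
def arcAfter (Γ : PositiveClosedCurve) (a : Fin m → ℂ) (k : Fin m) : Set (OnePoint ℂ) :=
  {p | ∃ s u : ℝ, p = (Γ.γ s : OnePoint ℂ) ∧ u < s ∧ Γ.γ u = a k ∧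
    ∀ v ∈ Ioc u s, ∀ j, Γ.γ v ≠ a j}

end PositiveClosedCurve

/-- `S`, the Riemann sphere without the points `a₁, …, aₘ`. It contains `∞`. -/
abbrev PuncturedSphere {m : ℕ} (a : Fin m → ℂ) : Type :=
  {p : OnePoint ℂ // ∀ k, p ≠ (a k : OnePoint ℂ)}

section Covering

variable {m n : ℕ} {a : Fin m → ℂ} {X : Type*} [TopologicalSpace X]

/-- `σ` is the deck transformation `σₖ` of the covering `ρ : X → S` with base point `x₀`,
which lies over `D₊`: there is a path in `X` from `x₀` to `σ x₀` whose projection starts in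
`D₊`, leaves it through the subarc joining `aₖ₋₁` to `aₖ`, stays in `D₋`, and returns to `D₊`
through the subarc joining `aₖ` to `aₖ₊₁`; so it meets `Γ` exactly twice and goes once around
`aₖ` in the positive direction. -/
def IsStandardDeckTransformation (Γ : PositiveClosedCurve) (ρ : X → PuncturedSphere a)
    (x₀ : X) (k : Fin m) (σ : X ≃ₜ X) : Prop :=
  (∀ x, ρ (σ x) = ρ x) ∧
  ∃ c : C(unitInterval, X), c 0 = x₀ ∧ c 1 = σ x₀ ∧
    ∃ s₁ s₂ : unitInterval, s₁ < s₂ ∧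
      (∀ s < s₁, (ρ (c s)).1 ∈ Γ.inner) ∧
      (ρ (c s₁)).1 ∈ Γ.arcBefore a k ∧
      (∀ s ∈ Ioo s₁ s₂, (ρ (c s)).1 ∈ Γ.outer) ∧
      (ρ (c s₂)).1 ∈ Γ.arcAfter a k ∧
      (∀ s > s₂, (ρ (c s)).1 ∈ Γ.inner)

/-- Let `p` be a local homeomorphism of `X` to the sphere. `Y` is an invertible matrix solution
of `Y' = A Y` on `X` without the points over `∞`: it takes invertible values and, in the local
coordinate `z = p x`, it is a holomorphic function satisfying the equation. (The values of `Y`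
over `∞` play no role.) -/
def IsFundamentalSolution (A : ℂ → Matrix (Fin n) (Fin n) ℂ) (p : X → OnePoint ℂ)
    (Y : X → Matrix (Fin n) (Fin n) ℂ) : Prop :=
  ∀ (x : X) (z : ℂ), p x = (z : OnePoint ℂ) →
    IsUnit (Y x) ∧
    ∃ F : ℂ → Matrix (Fin n) (Fin n) ℂ,
      (∀ᶠ x' in 𝓝 x, ∀ z' : ℂ, p x' = (z' : OnePoint ℂ) → Y x' = F z') ∧
      ∀ᶠ w in 𝓝 z, ∀ i j, HasDerivAt (fun v => F v i j) ((A w * F w) i j) w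

/-- No two eigenvalues of `E` differ by a nonzero integer. -/
def IsNonResonant (E : Matrix (Fin n) (Fin n) ℂ) : Prop :=
  ∀ l ∈ spectrum ℂ E, ∀ l' ∈ spectrum ℂ E, ∀ N : ℤ, l - l' = (N : ℂ) → N = 0

/-- Admissible data `[M₁, …, Mₘ]`, `[E₁, …, Eₘ]`. -/
structure IsAdmissibleData (M E : Fin m → Matrix (Fin n) (Fin n) ℂ) : Prop where
  prod_eq_one : (List.ofFn M).prod = 1
  similar : ∀ k, ∃ C : GL (Fin n) ℂ, M k =
    (↑C⁻¹ : Matrix (Fin n) (Fin n) ℂ) *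
      NormedSpace.exp ((-(2 * Real.pi * Complex.I) : ℂ) • E k) * (C : Matrix (Fin n) (Fin n) ℂ)
  nonResonant : ∀ k, IsNonResonant (E k)

/-- The matrix function `Z` is analytic with invertible values on `U`. -/
def IsAnalyticInvertibleOn (Z : ℂ → Matrix (Fin n) (Fin n) ℂ) (U : Set ℂ) : Prop :=
  ∀ z ∈ U, IsUnit (Z z) ∧ ∀ i j, AnalyticAt ℂ (fun w => Z w i j) z

/-- The universal covering surface of the punctured disk `0 < |z - a| < ε`, realized by the
coordinate `w = log (z - a)` as a half-plane with covering map `w ↦ a + exp w`. -/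
abbrev LogDisk (ε : ℝ) : Type := {w : ℂ // w.re < Real.log ε}

/-- The exterior domain `R < |z| < ∞`. -/
abbrev PuncturedNhdInfty (R : ℝ) : Type := {z : ℂ // R < ‖z‖}

/-- The system `Y' = A(z) Y` is of standard form with respect to the data `M`, `E`, with
singularities `a₁, …, aₘ` and indices `κ₁ ≥ … ≥ κₙ`. Here `ρ` is the universal covering of the
punctured sphere and `σ₁, …, σₘ` are the standard deck transformations. -/
structure IsStandardForm (ρ : X → PuncturedSphere a) (σ : Fin m → X ≃ₜ X)
    (M E : Fin m → Matrix (Fin n) (Fin n) ℂ) (κ : Fin n → ℤ)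
    (A : ℂ → Matrix (Fin n) (Fin n) ℂ) : Prop where
  antitone : Antitone κ
  /-- in the plane there are no singularities other than `a₁, …, aₘ` -/
  analytic : ∀ z, (∀ k, z ≠ a k) → ∀ i j, AnalyticAt ℂ (fun w => A w i j) z
  /-- the singularity at `∞` is apparent: the solutions live on the universal covering of the
  sphere without `a₁, …, aₘ`, with the points over `∞` removed -/
  apparent : ∃ Y : X → Matrix (Fin n) (Fin n) ℂ, IsFundamentalSolution A (fun x => (ρ x).1) Y
  /-- the monodromy is the simultaneous similarity class of `[M₁, …, Mₘ]`, where
  `Y(x) = Y(σₖ x) χ(σₖ)` -/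
  monodromy : ∀ Y : X → Matrix (Fin n) (Fin n) ℂ,
    IsFundamentalSolution A (fun x => (ρ x).1) Y →
    ∃ χ : Fin m → GL (Fin n) ℂ,
      (∀ k x, (ρ x).1 ≠ ∞ → Y x = Y (σ k x) * (χ k : Matrix (Fin n) (Fin n) ℂ)) ∧
      ∃ C : GL (Fin n) ℂ, ∀ k, M k = ((C⁻¹ * χ k * C : GL (Fin n) ℂ) : Matrix (Fin n) (Fin n) ℂ)
  /-- near `aₖ` the solutions are `Z(z) (z - aₖ)^{Eₖ} C`, with `Z` analytic and invertible also
  at `aₖ` -/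
  local_form : ∀ k, ∃ ε > 0, (∀ j, j ≠ k → ε ≤ dist (a j) (a k)) ∧
    ∀ U : LogDisk ε → Matrix (Fin n) (Fin n) ℂ,
      IsFundamentalSolution A (fun w => ((a k + Complex.exp w.1 : ℂ) : OnePoint ℂ)) U →
      ∃ (Z : ℂ → Matrix (Fin n) (Fin n) ℂ) (C : GL (Fin n) ℂ),
        IsAnalyticInvertibleOn Z (Metric.ball (a k) ε) ∧
        ∀ w, U w = Z (a k + Complex.exp w.1) * NormedSpace.exp (w.1 • E k) *
          (C : Matrix (Fin n) (Fin n) ℂ)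
  /-- near `∞` the solutions are `diag (z^κ₁, …, z^κₙ) Z(z) C`, with `Z` analytic and invertible
  also at `∞`; here `G ζ = Z (1/ζ)` -/
  infinity_form : ∃ R > 0, (∀ j, ‖a j‖ ≤ R) ∧
    ∀ U : PuncturedNhdInfty R → Matrix (Fin n) (Fin n) ℂ,
      IsFundamentalSolution A (fun z => (z.1 : OnePoint ℂ)) U →
      ∃ (G : ℂ → Matrix (Fin n) (Fin n) ℂ) (C : GL (Fin n) ℂ),
        IsAnalyticInvertibleOn G (Metric.ball 0 R⁻¹) ∧
        ∀ z, U z = Matrix.diagonal (fun i => z.1 ^ κ i) * G z.1⁻¹ *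
          (C : Matrix (Fin n) (Fin n) ℂ)

/-- The value `V(z)` of a matrix polynomial. -/
def evalMatrix (V : Matrix (Fin n) (Fin n) (Polynomial ℂ)) (z : ℂ) : Matrix (Fin n) (Fin n) ℂ :=
  V.map (Polynomial.eval z)

/-- The shape of the transition matrix. The rows and columns are divided into blocks of equal
index; for `κ₁ ≥ … ≥ κₙ` these blocks are consecutive. Blocks below the diagonal vanish, the block
belonging to the values `κ̄ᵢ ≥ κ̄ⱼ` has degree at most `κ̄ᵢ - κ̄ⱼ` (so that the diagonal blocks are
constant), and the diagonal blocks are invertible. -/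
structure IsBlockTriangular (κ : Fin n → ℤ) (V : Matrix (Fin n) (Fin n) (Polynomial ℂ)) :
    Prop where
  eq_zero : ∀ i j, κ i < κ j → V i j = 0
  natDegree_le : ∀ i j, κ j ≤ κ i → ((V i j).natDegree : ℤ) ≤ κ i - κ j
  isUnit_diag : ∀ c : ℤ,
    IsUnit (Matrix.of fun i j : {i : Fin n // κ i = c} => (V i.1 j.1).coeff 0)

/-- `A₂ = V' V⁻¹ + V A₁ V⁻¹` away from the singularities. -/
def CoefficientsRelated (a : Fin m → ℂ) (A₁ A₂ : ℂ → Matrix (Fin n) (Fin n) ℂ)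
    (V : Matrix (Fin n) (Fin n) (Polynomial ℂ)) : Prop :=
  ∀ z : ℂ, (∀ k, z ≠ a k) →
    A₂ z = evalMatrix (V.map Polynomial.derivative) z * (evalMatrix V z)⁻¹ +
      evalMatrix V z * A₁ z * (evalMatrix V z)⁻¹

/-- Any two invertible matrix solutions are related by `Y₂ = V Y₁ C` with a constant invertible
matrix `C`. -/
def SolutionsRelated (ρ : X → PuncturedSphere a) (A₁ A₂ : ℂ → Matrix (Fin n) (Fin n) ℂ)
    (V : Matrix (Fin n) (Fin n) (Polynomial ℂ)) : Prop :=
  ∀ Y₁ Y₂ : X → Matrix (Fin n) (Fin n) ℂ,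
    IsFundamentalSolution A₁ (fun x => (ρ x).1) Y₁ →
    IsFundamentalSolution A₂ (fun x => (ρ x).1) Y₂ →
    ∃ C : GL (Fin n) ℂ, ∀ (x : X) (z : ℂ), (ρ x).1 = (z : OnePoint ℂ) →
      Y₂ x = evalMatrix V z * Y₁ x * (C : Matrix (Fin n) (Fin n) ℂ)

end Covering

end

/-! Let `Y₁`, `Y₂` solve the two systems. Both monodromies are conjugate to `M`, so for a suitable
constant `C` the quotient `Y₂ C Y₁⁻¹` is invariant under every `σ k`. It therefore descends to a
function `f` on the plane without the `a k`, with invertible values and `f' = A₂ f - f A₁`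
(`IsStandardForm.exists_transition`). Near `a k`, writing `z = a k + exp w`, the local forms give `f
= Z₂ exp(wE) B exp(-wE) Z₁⁻¹` with `B` constant. Since `f` is single-valued, `B` commutes with
`exp(2πiE)`, and nonresonance improves this to commuting with `E` (`IsNonResonant.commute`). Hence
`f = Z₂ B Z₁⁻¹` extends, invertibly, over `a k`. Near `∞` the entry `f i j` is `z ^ (κ₂ i - κ₁ j)`
times a bounded function, so by Liouville it is a polynomial of at most that degree, and zero if the
exponent is negative. Thus `f` is a matrix polynomial `V`, invertible at every point
(`exists_evalMatrix_eq`). If `κ₁ k > κ₂ k`, then `V` has a zero block on rows `≥ k` and columns `≤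
k`, too large for an invertible matrix; exchanging the systems gives equality of the indices. Then
`V` is block triangular with constant diagonal blocks. Relation (2) follows from (1) because `V Y₁`
solves the second system and solutions are unique up to a constant right factor; (1) follows from
(2) by differentiation. The topological core is the descent (`exists_descent`), which does not pass
through generators of the deck group. For each `k` the sphere is slit along the closed arc of `Γ`
from `a k` forward to the point preceding `a k`, leaving only the gap before `a k` open. This arc
contains all punctures, so a loop avoiding it lifts to a loop, and the sheet `R k` through `x₀` over
the slit sphere is embedded by `ρ`. The sheets agree over `D₊`; over `D₋` consecutive ones differ by
a single `σ k`. An invariant function thus takes consistent values on their union, which covers the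
punctured sphere. -/

/-! ### Homeomorphisms of the plane with prescribed support -/

theorem isPreconnected_ball_diff_center (c : ℂ) (r : ℝ) :
    IsPreconnected (Metric.ball c r \ {c}) := by
  have h : Metric.ball c r \ {c} =
      (fun p : ℝ × ℝ => c + p.1 * Complex.exp (p.2 * Complex.I)) '' (Ioo 0 r ×ˢ univ) := by
    ext z
    simp only [Set.mem_sdiff, Metric.mem_ball, mem_singleton_iff, mem_image, mem_prod, mem_Ioo,
      mem_univ, and_true, Prod.exists]
    constructor
    · rintro ⟨h1, h2⟩
      refine ⟨‖z - c‖, (z - c).arg, ⟨norm_pos_iff.2 (sub_ne_zero.2 h2), by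
        rwa [← dist_eq_norm]⟩, ?_⟩
      rw [Complex.norm_mul_exp_arg_mul_I]
      ring
    · rintro ⟨s, θ, ⟨hs, hr⟩, rfl⟩
      have h1 : ‖(s : ℂ) * Complex.exp (θ * Complex.I)‖ = s := by
        rw [norm_mul, Complex.norm_exp_ofReal_mul_I, mul_one, Complex.norm_real,
          Real.norm_of_nonneg hs.le]
      refine ⟨by rwa [dist_eq_norm, add_sub_cancel_left, h1], fun h => ?_⟩
      rw [add_eq_left] at h
      rw [h, norm_zero] at h1
      exact hs.ne h1
  rw [h]
  refine IsPreconnected.image ((convex_Ioo 0 r).prod convex_univ).isPreconnected _ ?_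
  fun_prop

theorem IsPreconnected.diff_singleton {U : Set ℂ} (hU : IsPreconnected U) (ho : IsOpen U) (p : ℂ) :
    IsPreconnected (U \ {p}) := by
  by_cases hp : p ∈ U
  swap
  · rwa [sdiff_singleton_eq_self hp]
  obtain ⟨r, hr, hrU⟩ := Metric.isOpen_iff.1 ho p hp
  have key : ∀ u v : Set ℂ, IsOpen u → IsOpen v → U \ {p} ⊆ u ∪ v →
      (U \ {p} ∩ v).Nonempty → Metric.ball p r \ {p} ⊆ u → (U \ {p} ∩ (u ∩ v)).Nonempty := by
    intro u v hu hv huv ⟨y, hy, hyv⟩ hB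
    -- A separation of `U \ {p}` whose part `u` contains the punctured ball becomes one of `U` once
    -- the ball is added to `u`.
    obtain ⟨z, hzU, hzu, hzv⟩ := hU (u ∪ Metric.ball p r) (v \ {p})
      (hu.union Metric.isOpen_ball) (hv.sdiff isClosed_singleton) (fun z hz => by
        by_cases hzp : z = p
        · exact Or.inl (Or.inr (hzp ▸ Metric.mem_ball_self hr))
        · exact (huv ⟨hz, hzp⟩).imp Or.inl (fun h => ⟨h, hzp⟩))
      ⟨p, hp, Or.inr (Metric.mem_ball_self hr)⟩ ⟨y, hy.1, hyv, hy.2⟩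
    exact ⟨z, ⟨hzU, hzv.2⟩, hzu.elim id (fun h => hB ⟨h, hzv.2⟩), hzv.1⟩
  intro u v hu hv huv hun hvn
  have hsub : Metric.ball p r \ {p} ⊆ U \ {p} := sdiff_subset_sdiff_left hrU
  by_cases h1 : (Metric.ball p r \ {p} ∩ v).Nonempty
  · by_cases h2 : (Metric.ball p r \ {p} ∩ u).Nonempty
    · exact (isPreconnected_ball_diff_center p r u v hu hv (hsub.trans huv) h2 h1).mono
        (inter_subset_inter_left _ hsub)
    · rw [inter_comm u]
      refine key v u hv hu (by rwa [union_comm]) hun fun z hz => (huv (hsub hz)).resolve_left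
        fun h => h2 ⟨z, hz, h⟩
  · exact key u v hu hv huv hvn fun z hz => (huv (hsub hz)).resolve_right fun h => h1 ⟨z, hz, h⟩

theorem IsPreconnected.diff_finset {U : Set ℂ} (hU : IsPreconnected U) (ho : IsOpen U)
    (F : Finset ℂ) : IsPreconnected (U \ F) := by
  classical
  induction F using Finset.induction_on with
  | empty => simpa using hU
  | insert q F _ ih =>
    have := ih.diff_singleton (ho.sdiff F.finite_toSet.isClosed) q
    rwa [sdiff_sdiff, union_comm, ← insert_eq, ← Finset.coe_insert] at this

/-- The map is the identity plus a cone-shaped bump in the direction `q - c`. The bump has Lipschitz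
constant `‖q - c‖ / R < 1`, so the sum is a homeomorphism. -/
theorem exists_homeomorph_of_mem_ball {c q : ℂ} {R : ℝ} (hq : q ∈ Metric.ball c R) :
    ∃ Φ : ℂ ≃ₜ ℂ, (∀ z, z ∉ Metric.ball c R → Φ z = z) ∧ Φ c = q := by
  have hR : 0 < R := Metric.pos_of_mem_ball hq
  let g : ℂ → ℂ := fun z => ((max (1 - ‖z - c‖ / R) 0 : ℝ) : ℂ) * (q - c)
  have hg : ∀ z w, ‖g z - g w‖ ≤ ‖q - c‖ / R * ‖z - w‖ := by
    intro z w
    have h1 : |max (1 - ‖z - c‖ / R) 0 - max (1 - ‖w - c‖ / R) 0| ≤ ‖z - w‖ / R := by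
      refine (abs_max_sub_max_le_abs _ _ _).trans ?_
      have : 1 - ‖z - c‖ / R - (1 - ‖w - c‖ / R) = (‖w - c‖ - ‖z - c‖) / R := by ring
      rw [this, abs_div, abs_of_pos hR]
      gcongr
      refine (abs_norm_sub_norm_le _ _).trans ?_
      rw [sub_sub_sub_cancel_right, norm_sub_rev]
    calc ‖g z - g w‖ = |max (1 - ‖z - c‖ / R) 0 - max (1 - ‖w - c‖ / R) 0| * ‖q - c‖ := by
          simp only [g]
          rw [← sub_mul, norm_mul, ← Complex.ofReal_sub, Complex.norm_real, Real.norm_eq_abs]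
      _ ≤ ‖z - w‖ / R * ‖q - c‖ := by gcongr
      _ = _ := by ring
  obtain ⟨K, hK⟩ : ∃ K : NNReal, (K : ℝ) = ‖q - c‖ / R := ⟨⟨‖q - c‖ / R, by positivity⟩, rfl⟩
  have hf : ApproximatesLinearOn (fun z => z + g z)
      ((ContinuousLinearEquiv.refl ℂ ℂ : ℂ ≃L[ℂ] ℂ) : ℂ →L[ℂ] ℂ) univ K := by
    intro z _ w _
    simpa [add_sub_add_comm, hK] using hg z w
  refine ⟨hf.toHomeomorph _ (Or.inr ?_), fun z hz => ?_, ?_⟩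
  · have : (K : ℝ) < 1 := by
      rw [hK, div_lt_one hR, ← dist_eq_norm]; exact hq
    rw [← NNReal.coe_lt_coe]
    simpa using this
  · change z + g z = z
    have : 1 ≤ ‖z - c‖ / R := by
      rw [one_le_div hR, ← dist_eq_norm]; simpa using hz
    simp [g, this]
  · change c + g c = q
    simp [g]

theorem IsPreconnected.exists_homeomorph {U : Set ℂ} (hU : IsPreconnected U) (ho : IsOpen U)
    {q q' : ℂ} (hq : q ∈ U) (hq' : q' ∈ U) :
    ∃ Φ : ℂ ≃ₜ ℂ, (∀ z, z ∉ U → Φ z = z) ∧ Φ q = q' := by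
  refine hU.induction₂ (fun x y => ∃ Φ : ℂ ≃ₜ ℂ, (∀ z, z ∉ U → Φ z = z) ∧ Φ x = y)
    ?_ ?_ ?_ hq hq'
  · intro x hx
    obtain ⟨r, hr, hrU⟩ := Metric.isOpen_iff.1 ho x hx
    filter_upwards [mem_nhdsWithin_of_mem_nhds (Metric.ball_mem_nhds x hr)] with y hy
    obtain ⟨Φ, h1, h2⟩ := exists_homeomorph_of_mem_ball hy
    exact ⟨Φ, fun z hz => h1 z fun h => hz (hrU h), h2⟩
  · rintro x y z - - - ⟨Φ, h1, h2⟩ ⟨Ψ, h3, h4⟩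
    exact ⟨Φ.trans Ψ, fun w hw => by simp [h1 w hw, h3 w hw], by simp [h2, h4]⟩
  · rintro x y - - ⟨Φ, h1, h2⟩
    exact ⟨Φ.symm, fun w hw => by rw [Homeomorph.symm_apply_eq, h1 w hw],
      by rw [Homeomorph.symm_apply_eq, h2]⟩

theorem IsPreconnected.exists_homeomorph_gather {U : Set ℂ} (hU : IsPreconnected U)
    (ho : IsOpen U) {p : ℂ} {r : ℝ} (hr : 0 < r) (hpU : Metric.ball p r ⊆ U) (F : Finset ℂ)
    (hF : (F : Set ℂ) ⊆ U) :
    ∃ Φ : ℂ ≃ₜ ℂ, (∀ z, z ∉ U → Φ z = z) ∧ ∀ q ∈ F, Φ q ∈ Metric.ball p r := by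
  classical
  induction F using Finset.induction_on with
  | empty => exact ⟨Homeomorph.refl ℂ, by simp, by simp⟩
  | insert q F hqF ih =>
    rw [Finset.coe_insert, insert_subset_iff] at hF
    obtain ⟨Φ, h1, h2⟩ := ih hF.2
    have hΦU : ∀ z ∈ U, Φ z ∈ U := fun z hz => by
      by_contra h
      exact h (by rwa [Φ.injective (h1 _ h)])
    obtain ⟨q', hq', hq'F⟩ : ∃ q' ∈ Metric.ball p r, q' ∉ F.image Φ := by
      by_contra! h
      exact (infinite_of_mem_nhds p (Metric.ball_mem_nhds p hr)) ((F.image Φ).finite_toSet.subset h)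
    -- The points already gathered are removed from the domain, so `Ψ` fixes them while it moves `Φ
    -- q`.
    obtain ⟨Ψ, h3, h4⟩ := (hU.diff_finset ho (F.image Φ)).exists_homeomorph
      (ho.sdiff (F.image Φ).finite_toSet.isClosed) (q := Φ q) (q' := q')
      ⟨hΦU q hF.1, by simpa using hqF⟩ ⟨hpU hq', hq'F⟩
    refine ⟨Φ.trans Ψ, fun z hz => ?_, fun z hz => ?_⟩
    · rw [Homeomorph.trans_apply, h1 z hz, h3 z fun h => hz h.1]
    · rw [Homeomorph.trans_apply]
      rcases Finset.mem_insert.1 hz with rfl | hz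
      · rwa [h4]
      · rw [h3 _ fun h => h.2 (Finset.mem_coe.2 (Finset.mem_image_of_mem Φ hz))]
        exact h2 z hz

/-! ### Inversion coordinates on the sphere -/

/-- The coordinate `1 / (z - p)` of the Riemann sphere without `p`. -/
noncomputable def OnePoint.invCoord (p : ℂ) (q : OnePoint ℂ) : ℂ := q.elim 0 fun z => (z - p)⁻¹

open Classical in
/-- The inverse `ζ ↦ p + 1 / ζ` of `OnePoint.invCoord p`. -/
noncomputable def OnePoint.ofInvCoord (p : ℂ) (ζ : ℂ) : OnePoint ℂ :=
  if ζ = 0 then ∞ else ((p + ζ⁻¹ : ℂ) : OnePoint ℂ)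

namespace OnePoint

@[simp] theorem invCoord_infty (p : ℂ) : invCoord p ∞ = 0 := rfl
@[simp] theorem invCoord_coe (p z : ℂ) : invCoord p (z : OnePoint ℂ) = (z - p)⁻¹ := rfl
@[simp] theorem ofInvCoord_zero (p : ℂ) : ofInvCoord p 0 = ∞ := if_pos rfl
theorem ofInvCoord_of_ne {p ζ : ℂ} (h : ζ ≠ 0) :
    ofInvCoord p ζ = ((p + ζ⁻¹ : ℂ) : OnePoint ℂ) := if_neg h

theorem ofInvCoord_invCoord {p : ℂ} {q : OnePoint ℂ} (h : q ≠ (p : OnePoint ℂ)) :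
    ofInvCoord p (invCoord p q) = q := by
  induction q using OnePoint.rec with
  | infty => simp
  | coe z =>
    have hz : z - p ≠ 0 := sub_ne_zero.2 fun e => h (by rw [e])
    rw [invCoord_coe, ofInvCoord_of_ne (inv_ne_zero hz)]
    simp

theorem invCoord_ofInvCoord (p ζ : ℂ) : invCoord p (ofInvCoord p ζ) = ζ := by
  by_cases h : ζ = 0
  · simp [h]
  · simp [ofInvCoord_of_ne h]

theorem ofInvCoord_eq_infty_iff {p ζ : ℂ} : ofInvCoord p ζ = ∞ ↔ ζ = 0 := by
  by_cases h : ζ = 0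
  · simp [h]
  · simp [ofInvCoord_of_ne h, h]

theorem continuous_ofInvCoord (p : ℂ) : Continuous (ofInvCoord p) := by
  rw [continuous_iff_continuousAt]
  intro ζ
  by_cases h : ζ = 0
  · subst h
    rw [continuousAt_iff_punctured_nhds, ofInvCoord_zero]
    have h1 : Tendsto (fun ζ : ℂ => p + ζ⁻¹) (𝓝[≠] 0) (coclosedCompact ℂ) := by
      rw [coclosedCompact_eq_cocompact, ← Metric.cobounded_eq_cocompact]
      exact (tendsto_const_add_cobounded p).comp tendsto_inv₀_nhdsNE_zero
    refine (tendsto_coe_infty.comp h1).congr' ?_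
    filter_upwards [self_mem_nhdsWithin] with ζ hζ
    exact (ofInvCoord_of_ne hζ).symm
  · have h1 : ContinuousAt (fun ζ : ℂ => ((p + ζ⁻¹ : ℂ) : OnePoint ℂ)) ζ :=
      continuous_coe.continuousAt.comp (continuousAt_const.add (continuousAt_inv₀ h))
    refine h1.congr ?_
    filter_upwards [isOpen_ne.mem_nhds h] with ζ hζ
    exact (ofInvCoord_of_ne hζ).symm

theorem continuousAt_invCoord {p : ℂ} {q : OnePoint ℂ} (h : q ≠ (p : OnePoint ℂ)) :
    ContinuousAt (invCoord p) q := by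
  induction q using OnePoint.rec with
  | infty =>
    rw [continuousAt_infty', coclosedCompact_eq_cocompact, ← Metric.cobounded_eq_cocompact,
      invCoord_infty]
    exact tendsto_inv₀_cobounded.comp (tendsto_sub_const_cobounded p)
  | coe z =>
    have hz : z - p ≠ 0 := sub_ne_zero.2 fun e => h (by rw [e])
    rw [continuousAt_coe]
    exact (continuousAt_id.sub continuousAt_const).inv₀ hz

end OnePoint

/-! ### Local path connectedness and lifting to the covering -/

instance : LocallyPathConnectedSpace (OnePoint ℂ) := by
  have e := onePointEquivSphereOfFinrankEq (ι := Fin 3) (V := ℂ) (by simp)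
  have : Fact (Module.finrank ℝ (EuclideanSpace ℝ (Fin 3)) = 2 + 1) := ⟨by simp⟩
  have : LocallyPathConnectedSpace (Metric.sphere (0 : EuclideanSpace ℝ (Fin 3)) 1) :=
    ChartedSpace.locallyPathConnectedSpace (EuclideanSpace ℝ (Fin 2)) _
  exact e.isOpenEmbedding.locallyPathConnectedSpace

theorem IsLocalHomeomorph.locallyPathConnectedSpace {X Y : Type*} [TopologicalSpace X]
    [TopologicalSpace Y] [LocallyPathConnectedSpace Y] {f : X → Y} (hf : IsLocalHomeomorph f) :
    LocallyPathConnectedSpace X := by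
  refine ⟨fun x => ⟨fun s => ⟨fun hs => ?_, fun ⟨u, hu⟩ => mem_of_superset hu.1.1 hu.2⟩⟩⟩
  obtain ⟨e, hx, rfl⟩ := hf x
  obtain ⟨V, ⟨hV, hVc⟩, hVs⟩ := (LocallyPathConnectedSpace.path_connected_basis (e x)).mem_iff.1
    (e.image_mem_nhds hx (inter_mem hs (e.open_source.mem_nhds hx)))
  have hVt : V ⊆ e.target := hVs.trans (by
    rintro _ ⟨y, hy, rfl⟩
    exact e.map_source hy.2)
  refine ⟨e.symm '' V, ⟨?_, hVc.image' (e.continuousOn_symm.mono hVt)⟩, ?_⟩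
  · nth_rewrite 1 [← e.left_inv hx]
    exact e.symm.image_mem_nhds (e.map_source hx) hV
  · rintro _ ⟨w, hw, rfl⟩
    obtain ⟨y, hy, rfl⟩ := hVs hw
    rw [e.left_inv hy.2]
    exact hy.1

section Covering

variable {m : ℕ} {a : Fin m → ℂ} {X : Type*} [TopologicalSpace X] {ρ : X → PuncturedSphere a}

theorem isOpen_puncturedSphere (a : Fin m → ℂ) :
    IsOpen {p : OnePoint ℂ | ∀ k, p ≠ (a k : OnePoint ℂ)} := by
  rw [ofPred_forall]
  exact isOpen_iInter_of_finite fun k => isOpen_ne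

theorem IsCoveringMap.locallyPathConnectedSpace_puncturedSphere (hρ : IsCoveringMap ρ) :
    LocallyPathConnectedSpace X := by
  have : LocallyPathConnectedSpace (PuncturedSphere a) :=
    (isOpen_puncturedSphere a).locallyPathConnectedSpace
  exact hρ.isLocalHomeomorph.locallyPathConnectedSpace

/-- Maps from convex open sets to the punctured sphere lift. -/
theorem IsCoveringMap.exists_lift_of_convex (hρ : IsCoveringMap ρ) {U : Set ℂ} (hU : Convex ℝ U)
    (ho : IsOpen U) {g : ℂ → OnePoint ℂ} (hg : ContinuousOn g U)
    (hS : ∀ u ∈ U, ∀ k, g u ≠ (a k : OnePoint ℂ)) {u₀ : ℂ} (hu₀ : u₀ ∈ U) {x : X}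
    (hx : (ρ x).1 = g u₀) :
    ∃ s : ℂ → X, ContinuousOn s U ∧ s u₀ = x ∧ ∀ u ∈ U, (ρ (s u)).1 = g u := by
  classical
  have : ContractibleSpace U := hU.contractibleSpace ⟨u₀, hu₀⟩
  have : LocallyPathConnectedSpace U := ho.locallyPathConnectedSpace
  let G : C(U, PuncturedSphere a) := ⟨fun u => ⟨g u, hS u u.2⟩,
    (continuousOn_iff_continuous_domRestrict.1 hg).subtype_mk _⟩
  obtain ⟨F, ⟨h1, h2⟩, -⟩ := hρ.existsUnique_continuousMap_lifts G ⟨u₀, hu₀⟩ x (Subtype.ext hx)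
  refine ⟨fun u => if h : u ∈ U then F ⟨u, h⟩ else x, ?_, by simp [hu₀, h1], fun u hu => ?_⟩
  · rw [continuousOn_iff_continuous_domRestrict]
    convert F.continuous using 1
    ext u
    simp
  · simp only [hu, dite_true]
    exact congrArg Subtype.val (congrFun h2 ⟨u, hu⟩)

/-- A lift along a local coordinate is a local inverse of the covering map. -/
theorem IsCoveringMap.eventually_section_eq (hρ : IsCoveringMap ρ) {U : Set ℂ} (ho : IsOpen U)
    {g : ℂ → OnePoint ℂ} {h : OnePoint ℂ → ℂ} {u₀ : ℂ} (hu₀ : u₀ ∈ U) {s : ℂ → X}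
    (hs : ContinuousOn s U) (hρs : ∀ u ∈ U, (ρ (s u)).1 = g u)
    (hh : ContinuousAt h (g u₀)) (hhg : h (g u₀) = u₀) (hgh : ∀ᶠ q in 𝓝 (g u₀), g (h q) = q) :
    ∀ᶠ x in 𝓝 (s u₀), h (ρ x).1 ∈ U ∧ s (h (ρ x).1) = x := by
  have hρc : ContinuousAt (fun x => (ρ x).1) (s u₀) :=
    (continuous_subtype_val.comp hρ.continuous).continuousAt
  have e0 : (ρ (s u₀)).1 = g u₀ := hρs u₀ hu₀
  have hh' : ContinuousAt (fun x => h (ρ x).1) (s u₀) := by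
    refine ContinuousAt.comp (g := h) ?_ hρc
    rwa [e0]
  have hU : ∀ᶠ x in 𝓝 (s u₀), h (ρ x).1 ∈ U := by
    refine hh'.eventually (ho.mem_nhds ?_)
    change h (ρ (s u₀)).1 ∈ U
    rwa [e0, hhg]
  obtain ⟨N, hN, hx, hinj⟩ : ∃ N, IsOpen N ∧ s u₀ ∈ N ∧ InjOn ρ N := by
    obtain ⟨e, he, he'⟩ := hρ.isLocalHomeomorph (s u₀)
    exact ⟨e.source, e.open_source, he, he' ▸ e.injOn⟩
  have hsN : ∀ᶠ x in 𝓝 (s u₀), s (h (ρ x).1) ∈ N := by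
    have : ContinuousAt (fun x => s (h (ρ x).1)) (s u₀) := by
      refine ContinuousAt.comp (g := s) ?_ hh'
      rw [e0, hhg]
      exact hs.continuousAt (ho.mem_nhds hu₀)
    refine this.eventually (hN.mem_nhds ?_)
    change s (h (ρ (s u₀)).1) ∈ N
    rwa [e0, hhg]
  have hgh' : ∀ᶠ x in 𝓝 (s u₀), g (h (ρ x).1) = (ρ x).1 := by
    rw [← e0] at hgh
    exact hρc.eventually hgh
  filter_upwards [hU, hsN, hgh', hN.mem_nhds hx] with x h1 h2 h3 h4
  exact ⟨h1, hinj h2 h4 (Subtype.ext (by rw [hρs _ h1, h3]))⟩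

theorem IsCompact.exists_thickening_disjoint_coe {L : Set ℂ} (hL : IsCompact L)
    {K : Set (OnePoint ℂ)} (hK : IsClosed K) (hKL : ∀ z ∈ L, (z : OnePoint ℂ) ∉ K) :
    ∃ δ > 0, ∀ z ∈ Metric.thickening δ L, (z : OnePoint ℂ) ∉ K := by
  obtain ⟨δ, hδ, h⟩ := hL.exists_thickening_subset_open
    (hK.preimage OnePoint.continuous_coe).isOpen_compl hKL
  exact ⟨δ, hδ, h⟩

theorem IsPreconnected.thickening {L : Set ℂ} (hL : IsPreconnected L) (δ : ℝ) :
    IsPreconnected (Metric.thickening δ L) := by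
  rw [← add_ball_zero]
  rw [← add_image_prod]
  exact (hL.prod Metric.isPreconnected_ball).image _ continuous_add.continuousOn

/-- A path in the covering space which projects to a closed path is closed if its projection avoids
a continuum that contains all the punctures. -/
theorem IsCoveringMap.path_closed_of_avoids (hρ : IsCoveringMap ρ) {L : Set ℂ} (hL : IsCompact L)
    (hLc : IsConnected L) (haL : ∀ k, a k ∈ L) {c : C(unitInterval, X)}
    (hc : ∀ t, ∀ z ∈ L, (ρ (c t)).1 ≠ (z : OnePoint ℂ)) (h01 : ρ (c 0) = ρ (c 1)) : c 0 = c 1 := by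
  have hρc : Continuous (fun t => (ρ (c t)).1) :=
    continuous_subtype_val.comp (hρ.continuous.comp c.continuous)
  obtain ⟨p, hp⟩ := hLc.nonempty
  obtain ⟨δ, hδ, hU⟩ := hL.exists_thickening_disjoint_coe (isCompact_range hρc).isClosed
    (fun z hz ⟨t, ht⟩ => hc t z hz ht)
  have hball : Metric.ball p δ ⊆ Metric.thickening δ L := Metric.ball_subset_thickening hp δ
  -- `Φ` pushes all punctures into the ball of radius `δ / 2` about `p` and does not move the loop,
  -- which stays outside the thickening. In the coordinate `1 / (z - p)` the loop then lies in a
  -- disk free of moved punctures.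
  obtain ⟨Φ, hΦ, hΦa⟩ := (hLc.isPreconnected.thickening δ).exists_homeomorph_gather
    Metric.isOpen_thickening (half_pos hδ)
    ((Metric.ball_subset_ball (half_le_self hδ.le)).trans hball) (Finset.univ.image a)
    (by
      intro z hz
      obtain ⟨k, rfl⟩ : ∃ k, a k = z := by simpa using hz
      exact Metric.self_subset_thickening hδ L (haL k))
  let Ψ := Φ.onePointCongr
  have hΨ : ∀ t, Ψ (ρ (c t)).1 = (ρ (c t)).1 := fun t => by
    generalize hq : (ρ (c t)).1 = q
    induction q using OnePoint.rec with
    | infty => rfl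
    | coe z =>
      change ((Φ z : ℂ) : OnePoint ℂ) = z
      rw [hΦ z fun h => hU z h ⟨t, hq⟩]
  have hne : ∀ t, (ρ (c t)).1 ≠ (p : OnePoint ℂ) := fun t => hc t p hp
  have hζ : Continuous fun t => OnePoint.invCoord p (ρ (c t)).1 :=
    continuous_iff_continuousAt.2 fun t =>
      ContinuousAt.comp (g := OnePoint.invCoord p) (OnePoint.continuousAt_invCoord (hne t))
        hρc.continuousAt
  have hΨζ : ∀ t, Ψ.symm (OnePoint.ofInvCoord p (OnePoint.invCoord p (ρ (c t)).1)) =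
      (ρ (c t)).1 := fun t => by
    rw [OnePoint.ofInvCoord_invCoord (hne t), Homeomorph.symm_apply_eq, hΨ]
  have hζU : ∀ t, OnePoint.invCoord p (ρ (c t)).1 ∈ Metric.ball (0 : ℂ) (δ / 2)⁻¹ := fun t => by
    generalize hq : (ρ (c t)).1 = q
    induction q using OnePoint.rec with
    | infty => simpa using hδ
    | coe z =>
      have : z ∉ Metric.ball p δ := fun h => hU z (hball h) ⟨t, hq⟩
      rw [Metric.mem_ball, dist_eq_norm, not_lt] at this
      rw [OnePoint.invCoord_coe, mem_ball_zero_iff, norm_inv]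
      exact inv_strictAnti₀ (half_pos hδ) (by linarith)
  obtain ⟨s, hs, hs0, hsρ⟩ := hρ.exists_lift_of_convex (convex_ball (0 : ℂ) (δ / 2)⁻¹)
    Metric.isOpen_ball (g := fun ζ => Ψ.symm (OnePoint.ofInvCoord p ζ))
    (Ψ.symm.continuous.comp (OnePoint.continuous_ofInvCoord p)).continuousOn
    (by
      intro ζ hζ k h
      rw [Homeomorph.symm_apply_eq] at h
      change OnePoint.ofInvCoord p ζ = ((Φ (a k) : ℂ) : OnePoint ℂ) at h
      have h1 := congrArg (OnePoint.invCoord p) h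
      rw [OnePoint.invCoord_ofInvCoord, OnePoint.invCoord_coe] at h1
      have h2 := hΦa (a k) (by simp)
      have h3 : Φ (a k) - p ≠ 0 := by
        rintro h3
        rw [h3, inv_zero] at h1
        rw [h1, OnePoint.ofInvCoord_zero] at h
        exact OnePoint.infty_ne_coe _ h
      rw [Metric.mem_ball, dist_eq_norm] at h2
      rw [h1, mem_ball_zero_iff, norm_inv] at hζ
      exact (inv_strictAnti₀ (norm_pos_iff.2 h3) h2).not_gt hζ)
    (hζU 0) (x := c 0) (hΨζ 0).symm
  -- By uniqueness of lifts `c` is the section `s` along its own projection, so its endpoints agree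
  -- as soon as their projections do.
  have hcs : ⇑c = fun t => s (OnePoint.invCoord p (ρ (c t)).1) := by
    refine hρ.eq_of_comp_eq c.continuous
      (continuous_iff_continuousAt.2 fun t => ContinuousAt.comp (g := s)
        (hs.continuousAt (Metric.isOpen_ball.mem_nhds (hζU t))) hζ.continuousAt) ?_ 0 hs0.symm
    funext t
    exact Subtype.ext (by rw [Function.comp, Function.comp, hsρ _ (hζU t), hΨζ])
  rw [congrFun hcs 1, ← h01, hs0]

theorem IsCoveringMap.exists_joinedIn (hρ : IsCoveringMap ρ) {Ω : Set (OnePoint ℂ)}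
    (hΩ : ∀ q ∈ Ω, ∀ k, q ≠ (a k : OnePoint ℂ)) {x : X} {q : OnePoint ℂ}
    (h : JoinedIn Ω (ρ x).1 q) :
    ∃ y, (ρ y).1 = q ∧ JoinedIn ((fun x => (ρ x).1) ⁻¹' Ω) x y := by
  let c : C(unitInterval, PuncturedSphere a) :=
    ⟨fun t => ⟨h.somePath t, hΩ _ (h.somePath_mem t)⟩, h.somePath.continuous.subtype_mk _⟩
  obtain ⟨c', h1, h2⟩ := hρ.exists_path_lifts c x (Subtype.ext (by simp [c]))
  have h3 : ∀ t, (ρ (c' t)).1 = h.somePath t := fun t => congrArg Subtype.val (congrFun h1 t)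
  refine ⟨c' 1, by rw [h3]; simp, ⟨⟨c', h2, rfl⟩, fun t => ?_⟩⟩
  change (ρ (c' t)).1 ∈ Ω
  rw [h3]
  exact h.somePath_mem t

end Covering

theorem ContinuousMap.joinedIn_of_forall_Icc {Y : Type*} [TopologicalSpace Y]
    (c : C(unitInterval, Y)) {F : Set Y} {s t : unitInterval} (hst : s ≤ t)
    (h : ∀ u ∈ Icc s t, c u ∈ F) : JoinedIn F (c s) (c t) := by
  have h1 : IsPathConnected (Icc (s : ℝ) t) := (convex_Icc _ _).isPathConnected ⟨s, le_rfl, hst⟩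
  have h2 := h1.image (c.continuous.comp (continuous_projIcc (a := (0 : ℝ)) (b := 1)
    (h := zero_le_one)))
  have h3 := h2.joinedIn _ (mem_image_of_mem _ (left_mem_Icc.2 (show (s : ℝ) ≤ t from hst))) _
    (mem_image_of_mem _ (right_mem_Icc.2 (show (s : ℝ) ≤ t from hst)))
  simp only [Function.comp, projIcc_val] at h3
  refine h3.mono ?_
  rintro _ ⟨u, hu, rfl⟩
  refine h _ ?_
  have hu' : u ∈ Icc (0 : ℝ) 1 := ⟨s.2.1.trans hu.1, hu.2.trans t.2.2⟩
  rw [projIcc_of_mem zero_le_one hu']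
  exact hu

/-! ### Subarcs of the curve and slit spheres -/

namespace PositiveClosedCurve

variable {m : ℕ} (Γ : PositiveClosedCurve)

theorem exists_eq_add_int {v w : ℝ} (h : Γ.γ v = Γ.γ w) : ∃ N : ℤ, v = w + N := by
  have hf : ∀ v, Γ.γ (Int.fract v) = Γ.γ v := fun v => by
    have := Γ.periodic.sub_zsmul_eq ⌊v⌋ (x := v)
    rwa [zsmul_eq_mul, mul_one, Int.self_sub_floor] at this
  have := Γ.injOn ⟨Int.fract_nonneg v, Int.fract_lt_one v⟩
    ⟨Int.fract_nonneg w, Int.fract_lt_one w⟩ (by rw [hf, hf, h])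
  obtain ⟨N, hN⟩ := Int.fract_eq_fract.1 this
  exact ⟨N, by linarith⟩

theorem γ_add_int (v : ℝ) (N : ℤ) : Γ.γ (v + N) = Γ.γ v := by
  simpa using Γ.periodic.zsmul N v

theorem γ_sub_int (v : ℝ) (N : ℤ) : Γ.γ (v - N) = Γ.γ v := by
  rw [← Γ.γ_add_int (v - N) N, sub_add_cancel]

/-- The last time before `t k` at which one of the points is met. -/
def timeBefore (t : Fin m → ℝ) (k : Fin m) : ℝ :=
  if k.1 = 0 then t ⟨m - 1, by have := k.2; omega⟩ - 1 else t ⟨k.1 - 1, by have := k.2; omega⟩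

variable {Γ} {a : Fin m → ℂ} {t : Fin m → ℝ}

theorem timeBefore_lt (ht : StrictMono t) (ht1 : ∀ i j, t i < t j + 1) (k : Fin m) :
    timeBefore t k < t k := by
  unfold timeBefore
  split_ifs with h
  · linarith [ht1 ⟨m - 1, by have := k.2; omega⟩ k]
  · exact ht (Fin.lt_def.2 (by simp; omega))

theorem le_timeBefore_add_one (ht : StrictMono t) (ht1 : ∀ i j, t i < t j + 1) (j k : Fin m) :
    t j ≤ timeBefore t k + 1 := by
  unfold timeBefore
  split_ifs with h
  · have : t j ≤ t ⟨m - 1, by have := k.2; omega⟩ :=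
      ht.monotone (Fin.le_def.2 (by have := j.2; simp; omega))
    linarith
  · exact (ht1 _ _).le

theorem exists_γ_timeBefore (hta : ∀ k, Γ.γ (t k) = a k) (k : Fin m) :
    ∃ j, Γ.γ (timeBefore t k) = a j := by
  unfold timeBefore
  split_ifs with h
  · exact ⟨_, by rw [Γ.periodic.sub_eq, hta]⟩
  · exact ⟨_, hta _⟩

theorem le_timeBefore_of_lt (ht : StrictMono t) {j k : Fin m} (hjk : j < k) :
    t j ≤ timeBefore t k := by
  unfold timeBefore
  rw [if_neg (by have := Fin.lt_def.1 hjk; omega)]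
  exact ht.monotone (Fin.le_def.2 (by have := Fin.lt_def.1 hjk; simp; omega))

/-- The slit runs from `a k` once around to the preceding point, so it contains every puncture, as
`IsCoveringMap.path_closed_of_avoids` requires. For `m = 1` it is a single point. -/
theorem mem_image_Icc (ht : StrictMono t) (ht1 : ∀ i j, t i < t j + 1)
    (hta : ∀ k, Γ.γ (t k) = a k) (j k : Fin m) :
    a j ∈ Γ.γ '' Icc (t k) (timeBefore t k + 1) := by
  by_cases h : k ≤ j
  · exact ⟨t j, ⟨ht.monotone h, le_timeBefore_add_one ht ht1 j k⟩, hta j⟩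
  · refine ⟨t j + 1, ⟨(ht1 k j).le, ?_⟩, by rw [Γ.periodic, hta]⟩
    linarith [le_timeBefore_of_lt ht (not_le.1 h)]

theorem exists_mem_Ioo_of_mem_arcBefore (ht : StrictMono t)
    (ht1 : ∀ i j, t i < t j + 1) (hta : ∀ k, Γ.γ (t k) = a k) {k : Fin m}
    {p : OnePoint ℂ} (hp : p ∈ Γ.arcBefore a k) :
    ∃ s ∈ Ioo (timeBefore t k) (t k), p = (Γ.γ s : OnePoint ℂ) := by
  obtain ⟨s, u, rfl, hsu, hu, hv⟩ := hp
  obtain ⟨N, rfl⟩ := Γ.exists_eq_add_int (hu.trans (hta k).symm)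
  refine ⟨s - N, ⟨?_, by linarith⟩, by rw [Γ.γ_sub_int]⟩
  by_contra h
  rw [not_lt] at h
  obtain ⟨j, hj⟩ := exists_γ_timeBefore hta k
  exact hv (timeBefore t k + N) ⟨by linarith, by linarith [timeBefore_lt ht ht1 k]⟩ j
    (by rw [Γ.γ_add_int, hj])

/-- The gap after `a k` is the gap before its successor. The non-cyclic successor suffices, since
sheets are compared along the chain down to index zero. -/
theorem exists_mem_Ioo_of_mem_arcAfter (ht : StrictMono t) (hta : ∀ k, Γ.γ (t k) = a k) {k k' : Fin m}
    (hk : k'.1 = k.1 + 1) {p : OnePoint ℂ} (hp : p ∈ Γ.arcAfter a k) :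
    ∃ s ∈ Ioo (timeBefore t k') (t k'), p = (Γ.γ s : OnePoint ℂ) := by
  obtain ⟨s, u, rfl, hsu, hu, hv⟩ := hp
  obtain ⟨N, rfl⟩ := Γ.exists_eq_add_int (hu.trans (hta k).symm)
  have hb : timeBefore t k' = t k := by
    unfold timeBefore
    rw [if_neg (by omega)]
    congr 1
    exact Fin.ext (by simp; omega)
  refine ⟨s - N, ⟨by linarith, ?_⟩, by rw [Γ.γ_sub_int]⟩
  by_contra h
  rw [not_lt] at h
  have h2 : t k < t k' := ht (Fin.lt_def.2 (by omega))
  exact hv (t k' + N) ⟨by linarith, by linarith⟩ k' (by rw [Γ.γ_add_int, hta])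

theorem disjoint_Ioo_Icc {s w : ℝ} {k : Fin m} (hs : s ∈ Ioo (timeBefore t k) (t k))
    (hw : w ∈ Icc (t k) (timeBefore t k + 1)) : Γ.γ s ≠ Γ.γ w := by
  intro h
  obtain ⟨N, rfl⟩ := Γ.exists_eq_add_int h
  have h1 : (N : ℝ) < 0 := by linarith [hs.2, hw.1]
  have h2 : (-1 : ℝ) < N := by linarith [hs.1, hw.2]
  have h3 : N < 0 := by exact_mod_cast h1
  have h4 : -1 < N := by exact_mod_cast h2
  omega

theorem disjoint_Ioo_Ioo (ht : StrictMono t) (ht1 : ∀ i j, t i < t j + 1) {s w : ℝ}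
    {k l : Fin m} (hkl : k < l) (hs : s ∈ Ioo (timeBefore t k) (t k))
    (hw : w ∈ Ioo (timeBefore t l) (t l)) : Γ.γ s ≠ Γ.γ w :=
  disjoint_Ioo_Icc hs ⟨(le_timeBefore_of_lt ht hkl).trans hw.1.le,
    hw.2.le.trans (le_timeBefore_add_one ht ht1 l k)⟩

theorem exists_mem_Ioo_of_notMem_Icc (k : Fin m) {q : ℂ} (hq : q ∈ range Γ.γ)
    (h : q ∉ Γ.γ '' Icc (t k) (timeBefore t k + 1)) :
    ∃ s ∈ Ioo (timeBefore t k) (t k), Γ.γ s = q := by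
  obtain ⟨s, rfl⟩ := hq
  obtain ⟨N, hN⟩ : ∃ N : ℤ, s - N ∈ Ioc (timeBefore t k) (timeBefore t k + 1) := by
    obtain ⟨N, hN, -⟩ := existsUnique_sub_zsmul_mem_Ioc one_pos s (timeBefore t k)
    exact ⟨N, by simpa using hN⟩
  refine ⟨s - N, ⟨hN.1, ?_⟩, Γ.γ_sub_int s N⟩
  by_contra h'
  exact h ⟨s - N, ⟨not_lt.1 h', hN.2⟩, Γ.γ_sub_int s N⟩

theorem exists_notMem_Icc (hta : ∀ k, Γ.γ (t k) = a k)
    (hm : 0 < m) {q : ℂ} (hq : q ∈ range Γ.γ) (hqa : ∀ k, q ≠ a k) :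
    ∃ k, q ∉ Γ.γ '' Icc (t k) (timeBefore t k + 1) := by
  obtain ⟨s, rfl⟩ := hq
  obtain ⟨N, hN⟩ : ∃ N : ℤ, s - N ∈ Ico (timeBefore t ⟨0, hm⟩) (timeBefore t ⟨0, hm⟩ + 1) := by
    obtain ⟨N, hN, -⟩ := existsUnique_sub_zsmul_mem_Ico one_pos s (timeBefore t ⟨0, hm⟩)
    exact ⟨N, by simpa using hN⟩
  rw [← Γ.γ_sub_int s N] at hqa ⊢
  generalize s - (N : ℝ) = s' at hN hqa
  have hb : timeBefore t ⟨0, hm⟩ = t ⟨m - 1, by omega⟩ - 1 := if_pos rfl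
  -- The first point met after time `s'` determines the gap that contains `γ s'`.
  have hex : ∃ k : ℕ, ∃ h : k < m, s' < t ⟨k, h⟩ := ⟨m - 1, by omega, by linarith [hN.2]⟩
  classical
  obtain ⟨hk, hks⟩ := Nat.find_spec hex
  have hmin := fun j => Nat.find_min hex (m := j)
  generalize Nat.find hex = k at hk hks hmin
  refine ⟨⟨k, hk⟩, ?_⟩
  rintro ⟨w, hw, h⟩
  refine disjoint_Ioo_Icc (Γ := Γ) ⟨?_, hks⟩ hw h.symm
  have hle : timeBefore t ⟨k, hk⟩ ≤ s' := by
    rcases Nat.eq_zero_or_pos k with rfl | hk0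
    · exact hN.1
    · unfold timeBefore
      rw [if_neg (by simpa using hk0.ne')]
      by_contra h'
      exact hmin (k - 1) (by omega) ⟨by omega, not_le.1 h'⟩
  refine lt_of_le_of_ne hle fun h' => ?_
  obtain ⟨j, hj⟩ := exists_γ_timeBefore hta ⟨k, hk⟩
  exact hqa j (h' ▸ hj)

theorem isPathConnected_inner : IsPathConnected Γ.inner :=
  (Γ.isOpen_inner.isConnected_iff_isPathConnected).1 Γ.isConnected_inner

theorem isPathConnected_outer : IsPathConnected Γ.outer :=
  (Γ.isOpen_outer.isConnected_iff_isPathConnected).1 Γ.isConnected_outer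

theorem notMem_inner (s : ℝ) : (Γ.γ s : OnePoint ℂ) ∉ Γ.inner := fun h => by
  have : (Γ.γ s : OnePoint ℂ) ∈ Γ.inner ∪ Γ.outer := Or.inl h
  rw [Γ.union_eq] at this
  exact this ⟨s, rfl⟩

theorem notMem_outer (s : ℝ) : (Γ.γ s : OnePoint ℂ) ∉ Γ.outer := fun h => by
  have : (Γ.γ s : OnePoint ℂ) ∈ Γ.inner ∪ Γ.outer := Or.inr h
  rw [Γ.union_eq] at this
  exact this ⟨s, rfl⟩

/-- This is what the condition `positive` is needed for: points in a gap can be reached from `D₊`,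
so each sheet covers them. -/
theorem mem_closure_inner (s : ℝ) : (Γ.γ s : OnePoint ℂ) ∈ closure Γ.inner := by
  have h1 : Tendsto (fun ε : ℝ => ((Γ.γ s + ε * Complex.I * deriv Γ.γ s : ℂ) : OnePoint ℂ))
      (𝓝[>] 0) (𝓝 (Γ.γ s : OnePoint ℂ)) := by
    have : Continuous (fun ε : ℝ => ((Γ.γ s + ε * Complex.I * deriv Γ.γ s : ℂ) : OnePoint ℂ)) :=
      OnePoint.continuous_coe.comp (by fun_prop)
    simpa using (this.tendsto 0).mono_left nhdsWithin_le_nhds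
  exact mem_closure_of_tendsto h1 ((Γ.positive s).mono fun ε h => h.1)

/-- The sphere without the closed arc from `a k` to the preceding point. -/
def slit (Γ : PositiveClosedCurve) (t : Fin m → ℝ) (k : Fin m) : Set (OnePoint ℂ) :=
  {q | ∀ z ∈ Γ.γ '' Icc (t k) (timeBefore t k + 1), q ≠ (z : OnePoint ℂ)}

theorem isOpen_slit (k : Fin m) : IsOpen (Γ.slit t k) := by
  have h : Γ.slit t k =
      ((fun z : ℂ => (z : OnePoint ℂ)) '' (Γ.γ '' Icc (t k) (timeBefore t k + 1)))ᶜ := by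
    ext q
    simp only [slit, mem_ofPred_eq, mem_compl_iff, mem_image]
    grind
  rw [h]
  exact ((isCompact_Icc.image Γ.contDiff.continuous).image
    OnePoint.continuous_coe).isClosed.isOpen_compl

theorem inner_subset_slit (k : Fin m) : Γ.inner ⊆ Γ.slit t k := by
  rintro q hq _ ⟨s, -, rfl⟩ rfl
  exact notMem_inner s hq

theorem outer_subset_slit (k : Fin m) : Γ.outer ⊆ Γ.slit t k := by
  rintro q hq _ ⟨s, -, rfl⟩ rfl
  exact notMem_outer s hq

theorem coe_mem_slit {s : ℝ} {k : Fin m} (hs : s ∈ Ioo (timeBefore t k) (t k)) :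
    (Γ.γ s : OnePoint ℂ) ∈ Γ.slit t k := by
  rintro _ ⟨w, hw, rfl⟩ h
  exact disjoint_Ioo_Icc hs hw (OnePoint.coe_injective h)

theorem ne_of_mem_slit (ht : StrictMono t) (ht1 : ∀ i j, t i < t j + 1)
    (hta : ∀ k, Γ.γ (t k) = a k) {k : Fin m} {q : OnePoint ℂ} (hq : q ∈ Γ.slit t k) (j : Fin m) :
    q ≠ (a j : OnePoint ℂ) :=
  hq _ (mem_image_Icc ht ht1 hta j k)

theorem mem_inner_or_outer_or (q : OnePoint ℂ) :
    q ∈ Γ.inner ∨ q ∈ Γ.outer ∨ ∃ z ∈ range Γ.γ, q = (z : OnePoint ℂ) := by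
  by_cases h : q ∈ range fun t : ℝ => (Γ.γ t : OnePoint ℂ)
  · obtain ⟨s, rfl⟩ := h
    exact Or.inr (Or.inr ⟨_, ⟨s, rfl⟩, rfl⟩)
  · have : q ∈ Γ.inner ∪ Γ.outer := by rwa [Γ.union_eq]
    exact this.imp id Or.inl

theorem exists_mem_slit (hta : ∀ k, Γ.γ (t k) = a k) (hm : 0 < m) {q : OnePoint ℂ}
    (hq : ∀ k, q ≠ (a k : OnePoint ℂ)) : ∃ k, q ∈ Γ.slit t k := by
  rcases Γ.mem_inner_or_outer_or q with h | h | ⟨z, hz, rfl⟩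
  · exact ⟨⟨0, hm⟩, inner_subset_slit _ h⟩
  · exact ⟨⟨0, hm⟩, outer_subset_slit _ h⟩
  · obtain ⟨k, hk⟩ := exists_notMem_Icc hta hm hz fun k h => hq k (by rw [h])
    refine ⟨k, fun w hw h => hk ?_⟩
    rwa [OnePoint.coe_injective h]

theorem mem_inner_or_outer_of_mem_slit (ht : StrictMono t) (ht1 : ∀ i j, t i < t j + 1)
    {k l : Fin m} (hkl : k ≠ l) {q : OnePoint ℂ} (hk : q ∈ Γ.slit t k) (hl : q ∈ Γ.slit t l) :
    q ∈ Γ.inner ∨ q ∈ Γ.outer := by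
  rcases Γ.mem_inner_or_outer_or q with h | h | ⟨z, hz, rfl⟩
  · exact Or.inl h
  · exact Or.inr h
  · obtain ⟨s, hs, h1⟩ := exists_mem_Ioo_of_notMem_Icc k hz fun h => hk z h rfl
    obtain ⟨w, hw, h2⟩ := exists_mem_Ioo_of_notMem_Icc l hz fun h => hl z h rfl
    rcases hkl.lt_or_gt with h | h
    · exact (disjoint_Ioo_Ioo ht ht1 h hs hw (h1.trans h2.symm)).elim
    · exact (disjoint_Ioo_Ioo ht ht1 h hw hs (h2.trans h1.symm)).elim

end PositiveClosedCurve

/-! ### Descent of functions invariant under the standard deck transformations -/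

section Descent

variable {m : ℕ} {a : Fin m → ℂ} {Γ : PositiveClosedCurve} {X : Type*} [TopologicalSpace X]
  {ρ : X → PuncturedSphere a}

theorem injOn_pathComponentIn_slit (hρ : IsCoveringMap ρ) {t : Fin m → ℝ} (ht : StrictMono t)
    (ht1 : ∀ i j, t i < t j + 1) (hta : ∀ k, Γ.γ (t k) = a k) (k : Fin m) (x₀ : X) :
    InjOn ρ (pathComponentIn ((fun x => (ρ x).1) ⁻¹' Γ.slit t k) x₀) := by
  intro y hy y' hy' h
  have hj : JoinedIn ((fun x => (ρ x).1) ⁻¹' Γ.slit t k) y y' := hy.symm.trans hy'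
  have hc := hρ.path_closed_of_avoids (isCompact_Icc.image Γ.contDiff.continuous)
    ((isConnected_Icc (a := t k) (b := PositiveClosedCurve.timeBefore t k + 1)
      (PositiveClosedCurve.le_timeBefore_add_one ht ht1 k k)).image Γ.γ
      Γ.contDiff.continuous.continuousOn)
    (fun j => PositiveClosedCurve.mem_image_Icc ht ht1 hta j k)
    (c := hj.somePath.toContinuousMap) (fun s => hj.somePath_mem s) (by simpa using h)
  simpa using hc

/-- `G` is the union of the sheets `R k` through `x₀` over the slit spheres. Agreement of `f ∘ ρ`
with `W` is claimed only on `G`; for transition functions it is extended to all of `X` later, by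
uniqueness of solutions. -/
theorem exists_descent (hΓ : Γ.PassesInOrder a) (hρ : IsCoveringMap ρ) (x₀ : X)
    (hx₀ : (ρ x₀).1 ∈ Γ.inner) (σ : Fin m → X ≃ₜ X)
    (hσ : ∀ k, IsStandardDeckTransformation Γ ρ x₀ k (σ k)) (hm : 0 < m)
    {α : Type*} (W : X → α) (hW : ∀ k x, W (σ k x) = W x) :
    ∃ (f : OnePoint ℂ → α) (G : Set X), IsOpen G ∧ x₀ ∈ G ∧
      (∀ q, (∀ k, q ≠ (a k : OnePoint ℂ)) → ∃ x ∈ G, (ρ x).1 = q) ∧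
      ∀ x ∈ G, f (ρ x).1 = W x := by
  obtain ⟨t, ht, ht1, hta⟩ := hΓ
  have := hρ.locallyPathConnectedSpace_puncturedSphere
  have hPc : Continuous fun x => (ρ x).1 := continuous_subtype_val.comp hρ.continuous
  let R : Fin m → Set X := fun k => pathComponentIn ((fun x => (ρ x).1) ⁻¹' Γ.slit t k) x₀
  have hRo : ∀ k, IsOpen (R k) := fun k =>
    ((PositiveClosedCurve.isOpen_slit k).preimage hPc).pathComponentIn x₀
  have hinj : ∀ k, InjOn ρ (R k) := fun k => injOn_pathComponentIn_slit hρ ht ht1 hta k x₀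
  have hR0 : ∀ k, x₀ ∈ R k := fun k =>
    mem_pathComponentIn_self (PositiveClosedCurve.inner_subset_slit k hx₀)
  have hRj : ∀ {k x y}, x ∈ R k → JoinedIn ((fun x => (ρ x).1) ⁻¹' Γ.slit t k) x y → y ∈ R k :=
    fun hx hxy => JoinedIn.trans hx hxy
  have hins : ∀ k, (fun x => (ρ x).1) ⁻¹' Γ.inner ⊆ (fun x => (ρ x).1) ⁻¹' Γ.slit t k :=
    fun k => preimage_mono (PositiveClosedCurve.inner_subset_slit k)
  have houts : ∀ k, (fun x => (ρ x).1) ⁻¹' Γ.outer ⊆ (fun x => (ρ x).1) ⁻¹' Γ.slit t k :=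
    fun k => preimage_mono (PositiveClosedCurve.outer_subset_slit k)
  have hslit : ∀ k q, q ∈ Γ.slit t k → ∀ j, q ≠ (a j : OnePoint ℂ) := fun k q hq j =>
    PositiveClosedCurve.ne_of_mem_slit ht ht1 hta hq j
  -- Take `u` on the defining path between its two crossings. The first part joins `x₀` to `u`
  -- through the gap of slit `k`. The second joins `u` to `σ k x₀` through the gap of the next slit,
  -- and is brought back to `x₀` by `(σ k)⁻¹`.
  have hdeck : ∀ k, ∃ u, (ρ u).1 ∈ Γ.outer ∧ u ∈ R k ∧
      ∀ k' : Fin m, k'.1 = k.1 + 1 → (σ k).symm u ∈ R k' := by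
    intro k
    obtain ⟨hσρ, c, hc0, hc1, s₁, s₂, hs, h1, h2, h3, h4, h5⟩ := hσ k
    obtain ⟨s, hs1, hs2⟩ := exists_between hs
    refine ⟨c s, h3 s ⟨hs1, hs2⟩, ?_, fun k' hk' => ?_⟩
    · refine hRj (hR0 k) ?_
      rw [← hc0]
      refine c.joinedIn_of_forall_Icc s.2.1 fun v hv => ?_
      rcases lt_trichotomy v s₁ with h | rfl | h
      · exact hins k (h1 v h)
      · obtain ⟨w, hw, h6⟩ := PositiveClosedCurve.exists_mem_Ioo_of_mem_arcBefore ht ht1 hta h2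
        rw [mem_preimage, h6]
        exact PositiveClosedCurve.coe_mem_slit hw
      · exact houts k (h3 v ⟨h, hv.2.trans_lt hs2⟩)
    · have hj : JoinedIn ((fun x => (ρ x).1) ⁻¹' Γ.slit t k') (c s) (c 1) := by
        refine c.joinedIn_of_forall_Icc s.2.2 fun v hv => ?_
        rcases lt_trichotomy v s₂ with h | rfl | h
        · exact houts k' (h3 v ⟨hs1.trans_le hv.1, h⟩)
        · obtain ⟨w, hw, h6⟩ := PositiveClosedCurve.exists_mem_Ioo_of_mem_arcAfter ht hta hk' h4
          rw [mem_preimage, h6]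
          exact PositiveClosedCurve.coe_mem_slit hw
        · exact hins k' (h5 v h)
      have hj' := hj.symm.map (σ k).symm.continuous
      rw [hc1, Homeomorph.symm_apply_apply] at hj'
      refine hRj (hR0 k') (hj'.mono ?_)
      rintro _ ⟨y, hy, rfl⟩
      rw [mem_preimage, ← hσρ, Homeomorph.apply_symm_apply]
      exact hy
  have hRin : ∀ {k y}, y ∈ R k → (ρ y).1 ∈ Γ.inner → ∀ l, y ∈ R l := by
    intro k y hy hin l
    obtain ⟨y', h1, h2⟩ := hρ.exists_joinedIn
      (fun q hq => hslit k q (PositiveClosedCurve.inner_subset_slit k hq))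
      (Γ.isPathConnected_inner.joinedIn _ hx₀ _ hin)
    have h3 : y' ∈ R k := hRj (hR0 k) (h2.mono (hins k))
    rw [← hinj k h3 hy (Subtype.ext h1)]
    exact hRj (hR0 l) (h2.mono (hins l))
  have hRout : ∀ {k q}, q ∈ Γ.outer → ∃ y ∈ R k, (ρ y).1 = q ∧
      ∀ k' : Fin m, k'.1 = k.1 + 1 → (σ k).symm y ∈ R k' := by
    intro k q hq
    obtain ⟨u, hu, huk, huk'⟩ := hdeck k
    obtain ⟨y, h1, h2⟩ := hρ.exists_joinedIn
      (fun q hq => hslit k q (PositiveClosedCurve.outer_subset_slit k hq))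
      (Γ.isPathConnected_outer.joinedIn _ hu _ hq)
    refine ⟨y, hRj huk (h2.mono (houts k)), h1, fun k' hk' => ?_⟩
    refine hRj (huk' k' hk') ((h2.map (σ k).symm.continuous).mono ?_)
    rintro _ ⟨y, hy, rfl⟩
    refine houts k' ?_
    rw [mem_preimage, ← (hσ k).1, Homeomorph.apply_symm_apply]
    exact hy
  -- Over `D₋` the sheet with index `n + 1` is the image under `(σ n)⁻¹` of the sheet with index
  -- `n`; invariance of `W` carries its values down to `R 0`.
  have hWout : ∀ n : ℕ, ∀ (k : Fin m) y y', k.1 = n → y ∈ R k → y' ∈ R ⟨0, hm⟩ →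
      ρ y = ρ y' → (ρ y).1 ∈ Γ.outer → W y = W y' := by
    intro n
    induction n with
    | zero =>
      intro k y y' hk hy hy' hyy' _
      obtain rfl : k = ⟨0, hm⟩ := Fin.ext hk
      rw [hinj _ hy hy' hyy']
    | succ n ih =>
      intro k y y' hk hy hy' hyy' hout
      obtain ⟨z, hz, hzq, hz'⟩ := hRout (k := ⟨n, by omega⟩) hout
      have h1 := hz' k hk
      have h2 : (σ ⟨n, by omega⟩).symm z = y := hinj k h1 hy (Subtype.ext (by
        rw [← hzq, ← (hσ ⟨n, by omega⟩).1 ((σ ⟨n, by omega⟩).symm z),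
          Homeomorph.apply_symm_apply]))
      rw [← h2, ← hW ⟨n, by omega⟩, Homeomorph.apply_symm_apply]
      exact ih ⟨n, by omega⟩ z y' rfl hz hy' (hyy' ▸ Subtype.ext hzq) (hzq ▸ hout)
  -- Distinct slit spheres have disjoint gaps, so they meet only over `D₊`, where the sheets
  -- coincide, and `D₋`, where `hWout` applies.
  have hWR : ∀ {k l y y'}, y ∈ R k → y' ∈ R l → ρ y = ρ y' → W y = W y' := by
    intro k l y y' hy hy' hyy'
    by_cases hkl : k = l
    · subst hkl
      rw [hinj k hy hy' hyy']
    have h1 : y ∈ (fun x => (ρ x).1) ⁻¹' Γ.slit t k := pathComponentIn_subset hy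
    have h2 : y' ∈ (fun x => (ρ x).1) ⁻¹' Γ.slit t l := pathComponentIn_subset hy'
    rw [mem_preimage, ← hyy'] at h2
    rcases PositiveClosedCurve.mem_inner_or_outer_of_mem_slit ht ht1 hkl h1 h2 with h | h
    · rw [hinj l (hRin hy h l) hy' hyy']
    · obtain ⟨z, hz, hzq, -⟩ := hRout (k := ⟨0, hm⟩) h
      have hzy : ρ y = ρ z := Subtype.ext hzq.symm
      rw [hWout k k y z rfl hy hz hzy h,
        hWout l l y' z rfl hy' hz (hyy' ▸ hzy) (hyy' ▸ h)]
  have hRsurj : ∀ k q, q ∈ Γ.slit t k → ∃ y ∈ R k, (ρ y).1 = q := by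
    intro k q hq
    rcases Γ.mem_inner_or_outer_or q with h | h | ⟨_, ⟨s, rfl⟩, rfl⟩
    · obtain ⟨y, h1, h2⟩ := hρ.exists_joinedIn
        (fun q hq => hslit k q (PositiveClosedCurve.inner_subset_slit k hq))
        (Γ.isPathConnected_inner.joinedIn _ hx₀ _ h)
      exact ⟨y, hRj (hR0 k) (h2.mono (hins k)), h1⟩
    · obtain ⟨y, hy, h1, -⟩ := hRout (k := k) h
      exact ⟨y, hy, h1⟩
    · obtain ⟨V, ⟨hV, hVc⟩, hVs⟩ := (LocallyPathConnectedSpace.path_connected_basis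
        (Γ.γ s : OnePoint ℂ)).mem_iff.1 ((PositiveClosedCurve.isOpen_slit k).mem_nhds hq)
      obtain ⟨q, hqV, hqin⟩ := mem_closure_iff_nhds.1 (Γ.mem_closure_inner s) V hV
      have hj := ((Γ.isPathConnected_inner.joinedIn _ hx₀ _ hqin).mono
        (PositiveClosedCurve.inner_subset_slit k)).trans
        ((hVc.joinedIn _ hqV _ (mem_of_mem_nhds hV)).mono hVs)
      obtain ⟨y, h1, h2⟩ := hρ.exists_joinedIn (hslit k) hj
      exact ⟨y, hRj (hR0 k) h2, h1⟩
  classical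
  refine ⟨fun q => if h : ∃ y, (∃ k, y ∈ R k) ∧ (ρ y).1 = q then W h.choose else W x₀,
    ⋃ k, R k, isOpen_iUnion hRo, mem_iUnion.2 ⟨⟨0, hm⟩, hR0 _⟩, fun q hq => ?_, fun x hx => ?_⟩
  · obtain ⟨k, hk⟩ := PositiveClosedCurve.exists_mem_slit hta hm hq
    obtain ⟨y, hy, hyq⟩ := hRsurj k q hk
    exact ⟨y, mem_iUnion.2 ⟨k, hy⟩, hyq⟩
  · have hex : ∃ y, (∃ k, y ∈ R k) ∧ (ρ y).1 = (ρ x).1 := ⟨x, mem_iUnion.1 hx, rfl⟩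
    refine (dif_pos hex).trans ?_
    obtain ⟨⟨k, hk⟩, h1⟩ := hex.choose_spec
    obtain ⟨l, hl⟩ := mem_iUnion.1 hx
    exact hWR hk hl (Subtype.ext h1)

end Descent

/-! ### Nonresonance and the commutant of the exponential -/

section BanachAlgebra

open NormedSpace

variable {𝔸 : Type*} [NormedRing 𝔸] [NormedAlgebra ℂ 𝔸] [CompleteSpace 𝔸]

theorem hasDerivAt_exp_smul_mul_exp_neg_smul (E B : 𝔸) (w : ℂ) :
    HasDerivAt (fun w : ℂ => exp (w • E) * B * exp (w • -E))
      (exp (w • E) * (E * B - B * E) * exp (w • -E)) w := by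
  refine (((hasDerivAt_exp_smul_const E w).mul_const B).mul
    (hasDerivAt_exp_smul_const' (-E) w)).congr_deriv ?_
  noncomm_ring

theorem exp_smul_mul_exp_neg_smul (E : 𝔸) (w : ℂ) : exp (w • E) * exp (w • -E) = 1 := by
  have h : Commute (w • E) (w • -E) := by
    rw [smul_neg]
    exact (Commute.refl _).neg_right
  let _ : NormedAlgebra ℚ 𝔸 := NormedAlgebra.restrictScalars ℚ ℂ 𝔸
  rw [← exp_add_of_commute h, smul_neg, add_neg_cancel, exp_zero]

theorem exp_smul_mul_mul_exp_neg_smul_of_commute {E B : 𝔸} {w : ℂ}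
    (h : Commute B (exp (w • E))) : exp (w • E) * B * exp (w • -E) = B := by
  rw [← h.eq, mul_assoc, exp_smul_mul_exp_neg_smul, mul_one]

/-- On an eigenvector of `ad E`, conjugation by `exp(zE)` is multiplication by `exp(νz)`. At `z = w`
it is trivial. -/
theorem exp_mul_eq_one_of_commutator_eq_smul {E B : 𝔸} {w ν : ℂ} (hB : B ≠ 0)
    (h : Commute B (exp (w • E))) (hν : E * B - B * E = ν • B) : Complex.exp (ν * w) = 1 := by
  have hd : ∀ z : ℂ, HasDerivAt
      (fun z : ℂ => Complex.exp (-(ν * z)) • (exp (z • E) * B * exp (z • -E))) 0 z := by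
    intro z
    have h1 := hasDerivAt_exp_smul_mul_exp_neg_smul E B z
    rw [hν, mul_smul_comm, smul_mul_assoc] at h1
    have h2 : HasDerivAt (fun z : ℂ => Complex.exp (-(ν * z))) (Complex.exp (-(ν * z)) * -ν) z := by
      have : HasDerivAt (fun z : ℂ => -(ν * z)) (-ν) z :=
        (((hasDerivAt_id z).const_mul ν).neg).congr_deriv (by simp)
      exact this.cexp
    refine (h2.smul h1).congr_deriv ?_
    rw [smul_smul, ← add_smul]
    simp
  have h3 := is_const_of_deriv_eq_zero (fun z => (hd z).differentiableAt)
    (fun z => (hd z).deriv) w 0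
  simp only [exp_smul_mul_mul_exp_neg_smul_of_commute h] at h3
  simp only [zero_smul, exp_zero, mul_zero, neg_zero, Complex.exp_zero, one_mul, mul_one,
    one_smul] at h3
  have h4 : (Complex.exp (-(ν * w)) - 1) • B = 0 := by rw [sub_smul, h3, one_smul, sub_self]
  have h5 := (smul_eq_zero.1 h4).resolve_right hB
  rw [Complex.exp_neg] at h5
  rw [← inv_eq_one]
  linear_combination h5

/-- When `ad E` is nilpotent of order two on `B`, conjugation by `exp(zE)` sends `B` to `B + z[E,
B]`. At `z = w` it returns `B`. This excludes nontrivial Jordan blocks of `ad E` at zero on the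
commutant. -/
theorem commute_of_commute_commutator {E B : 𝔸} {w : ℂ} (hw : w ≠ 0)
    (h : Commute B (exp (w • E))) (hc : Commute E (E * B - B * E)) : E * B - B * E = 0 := by
  have hd : ∀ z : ℂ, HasDerivAt
      (fun z : ℂ => exp (z • E) * B * exp (z • -E) - z • (E * B - B * E)) 0 z := by
    intro z
    have h1 := hasDerivAt_exp_smul_mul_exp_neg_smul E B z
    have h2 : exp (z • E) * (E * B - B * E) * exp (z • -E) = E * B - B * E := by
      refine exp_smul_mul_mul_exp_neg_smul_of_commute ?_
      exact ((hc.symm).smul_right z).exp_right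
    rw [h2] at h1
    exact (h1.sub ((hasDerivAt_id z).smul_const (E * B - B * E))).congr_deriv (by simp)
  have h3 := is_const_of_deriv_eq_zero (fun z => (hd z).differentiableAt)
    (fun z => (hd z).deriv) w 0
  simp only [exp_smul_mul_mul_exp_neg_smul_of_commute h] at h3
  simp only [zero_smul, exp_zero, one_mul, mul_one, sub_zero, sub_eq_self] at h3
  exact (smul_eq_zero.1 h3).resolve_left hw

end BanachAlgebra

/-- A nonzero range would contain an eigenvector `T u`. Its eigenvalue is zero, so `T (T u) = 0`,
which forces `T u = 0`. -/
theorem Module.End.eq_zero_of_forall_eigenvalue {V : Type*} [AddCommGroup V] [Module ℂ V]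
    [FiniteDimensional ℂ V] (T : Module.End ℂ V) (hT2 : ∀ v, T (T v) = 0 → T v = 0)
    (hT : ∀ (ν : ℂ) v, v ≠ 0 → T v = ν • v → ν = 0) : T = 0 := by
  by_contra hne
  obtain ⟨v, hv⟩ : ∃ v, T v ≠ 0 := by
    by_contra! h
    exact hne (LinearMap.ext h)
  let T' : Module.End ℂ (LinearMap.range T) :=
    T.restrict fun v _ => LinearMap.mem_range_self T v
  have : Nontrivial (LinearMap.range T) :=
    ⟨⟨⟨T v, LinearMap.mem_range_self T v⟩, 0, fun h => hv (congrArg Subtype.val h)⟩⟩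
  obtain ⟨ν, hν⟩ := Module.End.exists_eigenvalue T'
  obtain ⟨⟨_, u, rfl⟩, hu⟩ := hν.exists_hasEigenvector
  have h1 : T (T u) = ν • T u := congrArg Subtype.val hu.apply_eq_smul
  have h2 : T u ≠ 0 := fun h => hu.2 (Subtype.ext h)
  rw [hT ν _ h2 h1, zero_smul] at h1
  exact h2 (hT2 u h1)

section Matrices

variable {n : ℕ}

theorem SemiconjBy.aeval_polynomial {A : Type*} [Ring A] [Algebra ℂ A] {B E F : A}
    (h : SemiconjBy B E F) (p : Polynomial ℂ) :
    SemiconjBy B (Polynomial.aeval E p) (Polynomial.aeval F p) := by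
  induction p using Polynomial.induction_on' with
  | add p q hp hq => simpa using hp.add_right hq
  | monomial k c =>
    rw [Polynomial.aeval_monomial, Polynomial.aeval_monomial]
    exact SemiconjBy.mul_right (Algebra.commute_algebraMap_right c B) (h.pow_right k)

/-- The relation reads `B (ν + E) = E B`. Applying the characteristic polynomial `χ` of `E` gives `B
χ(ν + E) = χ(E) B = 0` by Cayley–Hamilton. Thus `χ(ν + E)` is singular, and by spectral mapping `ν +
E` and `E` share an eigenvalue. -/
theorem exists_mem_spectrum_sub_eq {E B : Matrix (Fin n) (Fin n) ℂ} {ν : ℂ} (hB : B ≠ 0)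
    (h : E * B - B * E = ν • B) :
    ∃ l ∈ spectrum ℂ E, ∃ l' ∈ spectrum ℂ E, l - l' = ν := by
  have hn : Nonempty (Fin n) := by
    by_contra hn
    rw [not_nonempty_iff] at hn
    exact hB (Subsingleton.elim _ _)
  have h1 : SemiconjBy B (algebraMap ℂ _ ν + E) E := by
    rw [SemiconjBy, mul_add, ← Algebra.commutes, Algebra.algebraMap_eq_smul_one, smul_mul_assoc,
      one_mul, ← h]
    abel
  have h2 := h1.aeval_polynomial E.charpoly
  rw [Matrix.aeval_self_charpoly, SemiconjBy, zero_mul] at h2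
  have h3 : ¬ IsUnit (Polynomial.aeval (algebraMap ℂ _ ν + E) E.charpoly) := fun hu =>
    hB ((hu.mul_left_eq_zero).1 h2)
  rw [← spectrum.zero_mem_iff ℂ, spectrum.map_polynomial_aeval_of_degree_pos _ _ (by
    rw [Matrix.charpoly_degree_eq_dim]
    exact_mod_cast Fintype.card_pos)] at h3
  obtain ⟨l, hl, hl0⟩ := h3
  refine ⟨l, Matrix.mem_spectrum_iff_isRoot_charpoly.2 hl0, l - ν, ?_, by ring⟩
  rw [← spectrum.add_mem_add_iff (s := ν), sub_add_cancel]
  exact hl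

open scoped Matrix.Norms.Operator in
/-- If no two eigenvalues of `E` differ by a nonzero integer, then matrices that commute with
`exp (2πi E)` commute with `E`. -/
theorem IsNonResonant.commute {E B : Matrix (Fin n) (Fin n) ℂ} (hE : IsNonResonant E)
    (hB : Commute B (NormedSpace.exp ((2 * Real.pi * Complex.I : ℂ) • E))) : Commute E B := by
  set P := NormedSpace.exp ((2 * Real.pi * Complex.I : ℂ) • E) with hP
  have hEP : Commute E P := ((Commute.refl E).smul_right _).exp_right
  let K : Submodule ℂ (Matrix (Fin n) (Fin n) ℂ) :=
    { carrier := {B | Commute B P}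
      add_mem' := fun h1 h2 => h1.add_left h2
      zero_mem' := Commute.zero_left P
      smul_mem' := fun c _ h => h.smul_left c }
  -- `T` is `ad E` on the commutant of `exp(2πiE)`. Its eigenvalues are integers and differences of
  -- eigenvalues of `E`, hence zero, and `hT2` rules out a nilpotent part.
  let T : K →ₗ[ℂ] K :=
    { toFun := fun B => ⟨E * B.1 - B.1 * E, (hEP.mul_left B.2).sub_left (B.2.mul_left hEP)⟩
      map_add' := fun B C => Subtype.ext (by simp [mul_add, add_mul]; abel)
      map_smul' := fun c B => Subtype.ext (by simp [smul_sub]) }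
  have hw : (2 * Real.pi * Complex.I : ℂ) ≠ 0 := Complex.two_pi_I_ne_zero
  have hT2 : ∀ B, T (T B) = 0 → T B = 0 := fun B h => Subtype.ext
    (commute_of_commute_commutator hw B.2 (sub_eq_zero.1 (congrArg Subtype.val h)))
  have hT : ∀ (ν : ℂ) (B : K), B ≠ 0 → T B = ν • B → ν = 0 := by
    intro ν B hB0 h
    have hB0' : B.1 ≠ 0 := fun h => hB0 (Subtype.ext h)
    have h' : E * B.1 - B.1 * E = ν • B.1 := congrArg Subtype.val h
    have h1 := exp_mul_eq_one_of_commutator_eq_smul hB0' B.2 h'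
    obtain ⟨N, hN⟩ := Complex.exp_eq_one_iff.1 h1
    have hN' : ν = N := mul_right_cancel₀ hw hN
    obtain ⟨l, hl, l', hl', hll⟩ := exists_mem_spectrum_sub_eq hB0' h'
    rw [hN', hE l hl l' hl' N (hll.trans hN'), Int.cast_zero]
  have hrange : T = 0 := Module.End.eq_zero_of_forall_eigenvalue T hT2 hT
  exact sub_eq_zero.1 (congrArg Subtype.val (LinearMap.congr_fun hrange ⟨B, hB⟩))

end Matrices

/-! ### Calculus of matrix functions -/

section MatrixCalculus

variable {n : ℕ}

/-- Entrywise differentiability of a matrix function. -/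
def HasEntryDerivAt (F : ℂ → Matrix (Fin n) (Fin n) ℂ) (F' : Matrix (Fin n) (Fin n) ℂ) (w : ℂ) :
    Prop :=
  ∀ i j, HasDerivAt (fun v => F v i j) (F' i j) w

open scoped Matrix.Norms.Operator in
theorem hasEntryDerivAt_iff {F : ℂ → Matrix (Fin n) (Fin n) ℂ} {F' : Matrix (Fin n) (Fin n) ℂ}
    {w : ℂ} : HasEntryDerivAt F F' w ↔ HasDerivAt F F' w := by
  have h : ∀ (F : ℂ → Fin n → Fin n → ℂ) (F' : Fin n → Fin n → ℂ),
      HasDerivAt F F' w ↔ ∀ i j, HasDerivAt (fun v => F v i j) (F' i j) w := fun F F' => by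
    rw [hasDerivAt_pi]
    exact forall_congr' fun i => hasDerivAt_pi
  exact (h F F').symm

variable {F G : ℂ → Matrix (Fin n) (Fin n) ℂ} {F' G' : Matrix (Fin n) (Fin n) ℂ} {w : ℂ}

theorem hasEntryDerivAt_const (C : Matrix (Fin n) (Fin n) ℂ) (w : ℂ) :
    HasEntryDerivAt (fun _ => C) 0 w := fun i j => hasDerivAt_const w (C i j)

open scoped Matrix.Norms.Operator in
theorem HasEntryDerivAt.mul (hF : HasEntryDerivAt F F' w) (hG : HasEntryDerivAt G G' w) :
    HasEntryDerivAt (fun v => F v * G v) (F' * G w + F w * G') w :=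
  hasEntryDerivAt_iff.2 ((hasEntryDerivAt_iff.1 hF).mul (hasEntryDerivAt_iff.1 hG))

theorem HasEntryDerivAt.mul_const (hF : HasEntryDerivAt F F' w) (C : Matrix (Fin n) (Fin n) ℂ) :
    HasEntryDerivAt (fun v => F v * C) (F' * C) w := by
  simpa using hF.mul (hasEntryDerivAt_const C w)

open scoped Matrix.Norms.Operator in
theorem HasEntryDerivAt.inv (hF : HasEntryDerivAt F F' w) (h : IsUnit (F w)) :
    HasEntryDerivAt (fun v => (F v)⁻¹) (-((F w)⁻¹ * F' * (F w)⁻¹)) w := by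
  rw [hasEntryDerivAt_iff] at hF ⊢
  obtain ⟨u, hu⟩ := h
  have h1 := hasFDerivAt_ringInverse (𝕜 := ℂ) u
  rw [hu] at h1
  have h2 := h1.comp_hasDerivAt w hF
  have h3 : (Ring.inverse ∘ F) = fun v => (F v)⁻¹ := by
    funext v
    rw [Function.comp, Matrix.nonsing_inv_eq_ringInverse]
  rw [h3] at h2
  refine h2.congr_deriv ?_
  have h4 : ((u⁻¹ : (Matrix (Fin n) (Fin n) ℂ)ˣ) : Matrix (Fin n) (Fin n) ℂ) = (F w)⁻¹ := by
    rw [← hu, Matrix.coe_units_inv]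
  rw [← h4]
  rfl

theorem HasEntryDerivAt.unique (hF : HasEntryDerivAt F F' w) (hF' : HasEntryDerivAt F G' w) :
    F' = G' := by
  ext i j
  exact (hF i j).unique (hF' i j)

theorem HasEntryDerivAt.congr (hF : HasEntryDerivAt F F' w) (h : ∀ᶠ v in 𝓝 w, G v = F v) :
    HasEntryDerivAt G F' w := fun i j =>
  (hF i j).congr_of_eventuallyEq (h.mono fun _ hv => congrFun (congrFun hv i) j)

theorem HasEntryDerivAt.continuousAt (hF : HasEntryDerivAt F F' w) : ContinuousAt F w := by
  refine continuousAt_pi.2 fun i => continuousAt_pi.2 fun j => (hF i j).continuousAt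

theorem ContinuousAt.eventually_isUnit_matrix (hF : ContinuousAt F w) (h : IsUnit (F w)) :
    ∀ᶠ v in 𝓝 w, IsUnit (F v) := by
  simp only [Matrix.isUnit_iff_isUnit_det, isUnit_iff_ne_zero] at h ⊢
  have : ContinuousAt (fun v => (F v).det) w :=
    (Continuous.matrix_det continuous_id).continuousAt.comp hF
  exact this.eventually_ne h

theorem eventually_eq_of_hasEntryDerivAt_zero (h : ∀ᶠ v in 𝓝 w, HasEntryDerivAt F 0 v) :
    ∀ᶠ v in 𝓝 w, F v = F w := by
  obtain ⟨r, hr, hF⟩ := Metric.eventually_nhds_iff_ball.1 h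
  filter_upwards [Metric.ball_mem_nhds w hr] with v hv
  ext i j
  exact Metric.isOpen_ball.is_const_of_deriv_eq_zero (f := fun v => F v i j)
    Metric.isPreconnected_ball
    (fun u hu => (hF u hu i j).differentiableAt.differentiableWithinAt)
    (fun u hu => (hF u hu i j).deriv) hv (Metric.mem_ball_self hr)

/-- Two solutions of a linear system differ by a constant right factor. -/
theorem eventually_inv_mul_eq {A : ℂ → Matrix (Fin n) (Fin n) ℂ}
    (hF : ∀ᶠ v in 𝓝 w, HasEntryDerivAt F (A v * F v) v)
    (hG : ∀ᶠ v in 𝓝 w, HasEntryDerivAt G (A v * G v) v) (hu : IsUnit (F w)) :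
    ∀ᶠ v in 𝓝 w, (F v)⁻¹ * G v = (F w)⁻¹ * G w := by
  have hu' := hF.self_of_nhds.continuousAt.eventually_isUnit_matrix hu
  refine eventually_eq_of_hasEntryDerivAt_zero (F := fun v => (F v)⁻¹ * G v) ?_
  filter_upwards [hF, hG, hu'] with v h1 h2 h3
  have h4 := (h1.inv h3).mul h2
  rwa [mul_assoc, mul_assoc (A v), Matrix.mul_nonsing_inv _ ((Matrix.isUnit_iff_isUnit_det _).1 h3),
    mul_one, neg_mul, mul_assoc, neg_add_cancel] at h4

theorem AnalyticAt.matrix_mul_entry {w : ℂ} (hF : ∀ i j, AnalyticAt ℂ (fun v => F v i j) w)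
    (hG : ∀ i j, AnalyticAt ℂ (fun v => G v i j) w) (i j : Fin n) :
    AnalyticAt ℂ (fun v => (F v * G v) i j) w := by
  simp only [Matrix.mul_apply]
  exact Finset.analyticAt_fun_sum _ fun k _ => (hF i k).mul (hG k j)

theorem HasEntryDerivAt.analyticAt {F' : ℂ → Matrix (Fin n) (Fin n) ℂ}
    (h : ∀ᶠ v in 𝓝 w, HasEntryDerivAt F (F' v) v) (i j : Fin n) :
    AnalyticAt ℂ (fun v => F v i j) w := by
  rw [Complex.analyticAt_iff_eventually_differentiableAt]
  exact h.mono fun v hv => (hv i j).differentiableAt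

theorem AnalyticAt.matrix_inv_entry (hF : ∀ i j, AnalyticAt ℂ (fun v => F v i j) w)
    (h : IsUnit (F w)) (i j : Fin n) : AnalyticAt ℂ (fun v => (F v)⁻¹ i j) w := by
  have h1 : ∀ᶠ v in 𝓝 w, HasEntryDerivAt F (Matrix.of fun i j => deriv (fun v => F v i j) v) v := by
    have : ∀ᶠ v in 𝓝 w, ∀ i j, AnalyticAt ℂ (fun v => F v i j) v :=
      eventually_all.2 fun i => eventually_all.2 fun j => (hF i j).eventually_analyticAt
    exact this.mono fun v hv i j => (hv i j).differentiableAt.hasDerivAt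
  have h2 := h1.self_of_nhds.continuousAt.eventually_isUnit_matrix h
  exact HasEntryDerivAt.analyticAt ((h1.and h2).mono fun v hv => hv.1.inv hv.2) i j

theorem IsAnalyticInvertibleOn.mul {U : Set ℂ} (hF : IsAnalyticInvertibleOn F U)
    (hG : IsAnalyticInvertibleOn G U) : IsAnalyticInvertibleOn (fun z => F z * G z) U :=
  fun z hz => ⟨(hF z hz).1.mul (hG z hz).1, AnalyticAt.matrix_mul_entry (hF z hz).2 (hG z hz).2⟩

theorem IsAnalyticInvertibleOn.inv {U : Set ℂ} (hF : IsAnalyticInvertibleOn F U) :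
    IsAnalyticInvertibleOn (fun z => (F z)⁻¹) U := fun z hz =>
  ⟨(Matrix.isUnit_nonsing_inv_iff).2 (hF z hz).1,
    AnalyticAt.matrix_inv_entry (hF z hz).2 (hF z hz).1⟩

theorem isAnalyticInvertibleOn_const {C : Matrix (Fin n) (Fin n) ℂ} (hC : IsUnit C) (U : Set ℂ) :
    IsAnalyticInvertibleOn (fun _ => C) U := fun _ _ => ⟨hC, fun _ _ => analyticAt_const⟩

theorem IsAnalyticInvertibleOn.mono {U V : Set ℂ} (hF : IsAnalyticInvertibleOn F U) (h : V ⊆ U) :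
    IsAnalyticInvertibleOn F V := fun z hz => hF z (h hz)

end MatrixCalculus

/-! ### Liouville-type theorems -/

section Growth

theorem Differentiable.eq_zero_of_norm_le_zpow {f : ℂ → ℂ} (hf : Differentiable ℂ f) {K R : ℝ}
    {N : ℤ} (hN : N < 0) (h : ∀ z, R < ‖z‖ → ‖f z‖ ≤ K * ‖z‖ ^ N) (z : ℂ) : f z = 0 := by
  refine hf.apply_eq_of_tendsto_cocompact z ?_
  rw [← Metric.cobounded_eq_cocompact]
  have h1 : Tendsto (fun z : ℂ => K * ‖z‖ ^ N) (Bornology.cobounded ℂ) (𝓝 (K * 0)) :=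
    ((tendsto_zpow_atTop_zero hN).comp tendsto_norm_cobounded_atTop).const_mul K
  rw [mul_zero] at h1
  exact squeeze_zero_norm' ((tendsto_norm_cobounded_atTop.eventually_gt_atTop R).mono h) h1

/-- Entire functions of polynomial growth are polynomials. -/
theorem Differentiable.exists_polynomial_of_norm_le_pow (N : ℕ) : ∀ {f : ℂ → ℂ},
    Differentiable ℂ f → ∀ {K R : ℝ}, (∀ z, R < ‖z‖ → ‖f z‖ ≤ K * ‖z‖ ^ N) →
    ∃ p : Polynomial ℂ, p.natDegree ≤ N ∧ ∀ z, f z = p.eval z := by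
  induction N with
  | zero =>
    intro f hf K R h
    have hb : Bornology.IsBounded (range f) := by
      obtain ⟨M, hM⟩ := (isCompact_closedBall (0 : ℂ) R).exists_bound_of_continuousOn
        hf.continuous.continuousOn
      refine isBounded_iff_forall_norm_le.2 ⟨max M K, ?_⟩
      rintro _ ⟨z, rfl⟩
      rcases le_or_gt ‖z‖ R with hz | hz
      · exact (hM z (by simpa using hz)).trans (le_max_left _ _)
      · exact (by simpa using h z hz : ‖f z‖ ≤ K).trans (le_max_right _ _)
    obtain ⟨c, hc⟩ := hf.exists_const_forall_eq_of_bounded hb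
    exact ⟨Polynomial.C c, by simp, fun z => by simp [hc z]⟩
  | succ N ih =>
    intro f hf K R h
    -- The difference quotient at the origin is again entire and grows with exponent one less; the
    -- bound `K + ‖f 0‖` absorbs the subtracted constant outside the unit disk.
    have hd : Differentiable ℂ (dslope f 0) := by
      rw [← differentiableOn_univ] at hf ⊢
      exact (Complex.differentiableOn_dslope univ_mem).2 hf
    obtain ⟨p, hp, hpf⟩ := ih hd (K := K + ‖f 0‖) (R := max R 1) (fun z hz => by
      have hz1 : 1 < ‖z‖ := (le_max_right _ _).trans_lt hz
      have hz0 : z ≠ 0 := norm_pos_iff.1 (zero_lt_one.trans hz1)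
      have h1 := h z ((le_max_left _ _).trans_lt hz)
      rw [dslope_of_ne _ hz0, slope_def_field, sub_zero, norm_div, div_le_iff₀ (by linarith)]
      have h2 : 1 ≤ ‖z‖ ^ (N + 1) := one_le_pow₀ hz1.le
      calc ‖f z - f 0‖ ≤ ‖f z‖ + ‖f 0‖ := norm_sub_le _ _
        _ ≤ K * ‖z‖ ^ (N + 1) + ‖f 0‖ * ‖z‖ ^ (N + 1) := by
          gcongr
          exact le_mul_of_one_le_right (norm_nonneg _) h2
        _ = _ := by ring)
    refine ⟨Polynomial.C (f 0) + Polynomial.X * p, ?_, fun z => ?_⟩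
    · refine (Polynomial.natDegree_add_le _ _).trans (max_le (by simp) ?_)
      refine Polynomial.natDegree_mul_le.trans ?_
      linarith [Polynomial.natDegree_X_le (R := ℂ)]
    · have := sub_smul_dslope f 0 z
      simp only [sub_zero, smul_eq_mul] at this
      simp only [Polynomial.eval_add, Polynomial.eval_C, Polynomial.eval_mul, Polynomial.eval_X]
      rw [← hpf, this]
      ring

end Growth

/-! ### Zero blocks and block triangular polynomial matrices -/

section Blocks

variable {n : ℕ}

/-- A square matrix with a zero block that reaches beyond the diagonal is singular. -/
theorem Matrix.det_eq_zero_of_zero_block {B : Matrix (Fin n) (Fin n) ℂ} (k : Fin n)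
    (h : ∀ i j, k ≤ i → j ≤ k → B i j = 0) : B.det = 0 := by
  rw [Matrix.twoBlockTriangular_det B (fun i => i < k)
    (fun i hi j hj => h i j (not_lt.1 hi) hj.le)]
  refine mul_eq_zero_of_right _ (Matrix.det_eq_zero_of_column_eq_zero ⟨k, lt_irrefl k⟩ fun i => ?_)
  exact h i.1 k (not_lt.1 i.2) le_rfl

theorem le_of_isUnit_of_forall_eq_zero {κ₁ κ₂ : Fin n → ℤ} (h₁ : Antitone κ₁) (h₂ : Antitone κ₂)
    {B : Matrix (Fin n) (Fin n) ℂ} (hB : IsUnit B) (h : ∀ i j, κ₂ i < κ₁ j → B i j = 0)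
    (k : Fin n) : κ₁ k ≤ κ₂ k := by
  by_contra! hk
  rw [Matrix.isUnit_iff_isUnit_det, isUnit_iff_ne_zero] at hB
  exact hB (Matrix.det_eq_zero_of_zero_block k fun i j hi hj =>
    h i j (((h₂ hi).trans_lt hk).trans_le (h₁ hj)))

/-- Diagonal blocks have degree at most zero, so the determinant does not depend on `z`.
Invertibility at one point, at all points, and of the diagonal blocks are therefore equivalent. -/
theorem det_evalMatrix_eq {κ : Fin n → ℤ} {V : Matrix (Fin n) (Fin n) (Polynomial ℂ)}
    (h0 : ∀ i j, κ i < κ j → V i j = 0)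
    (hd : ∀ i j, κ j ≤ κ i → ((V i j).natDegree : ℤ) ≤ κ i - κ j) (z : ℂ) :
    (evalMatrix V z).det = ∏ c ∈ Finset.univ.image κ,
      (Matrix.of fun i j : {i : Fin n // κ i = c} => (V i.1 j.1).coeff 0).det := by
  have hb : (evalMatrix V z).BlockTriangular (OrderDual.toDual ∘ κ) := fun i j hij => by
    change (V i j).eval z = 0
    rw [h0 i j hij, Polynomial.eval_zero]
  rw [hb.det]
  refine Finset.prod_congr rfl fun c _ => ?_
  congr 1
  ext i j
  have hij : κ i.1 = κ j.1 := i.2.trans j.2.symm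
  have h1 := hd i.1 j.1 hij.ge
  rw [hij, sub_self] at h1
  change (V i.1 j.1).eval z = (V i.1 j.1).coeff 0
  rw [Polynomial.eq_C_of_natDegree_eq_zero (p := V i.1 j.1) (by omega)]
  simp

theorem IsBlockTriangular.isUnit_evalMatrix {κ : Fin n → ℤ}
    {V : Matrix (Fin n) (Fin n) (Polynomial ℂ)} (hV : IsBlockTriangular κ V) (z : ℂ) :
    IsUnit (evalMatrix V z) := by
  rw [Matrix.isUnit_iff_isUnit_det, det_evalMatrix_eq hV.eq_zero hV.natDegree_le,
    isUnit_iff_ne_zero]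
  refine Finset.prod_ne_zero_iff.2 fun c _ => ?_
  rw [← isUnit_iff_ne_zero, ← Matrix.isUnit_iff_isUnit_det]
  exact hV.isUnit_diag c

theorem isBlockTriangular_of_isUnit {κ : Fin n → ℤ} {V : Matrix (Fin n) (Fin n) (Polynomial ℂ)}
    (h0 : ∀ i j, κ i < κ j → V i j = 0)
    (hd : ∀ i j, κ j ≤ κ i → ((V i j).natDegree : ℤ) ≤ κ i - κ j) {z : ℂ}
    (hu : IsUnit (evalMatrix V z)) : IsBlockTriangular κ V := by
  refine ⟨h0, hd, fun c => ?_⟩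
  rw [Matrix.isUnit_iff_isUnit_det, det_evalMatrix_eq h0 hd, isUnit_iff_ne_zero] at hu
  rw [Matrix.isUnit_iff_isUnit_det, isUnit_iff_ne_zero]
  by_cases hc : c ∈ Finset.univ.image κ
  · exact Finset.prod_ne_zero_iff.1 hu c hc
  · have : IsEmpty {i : Fin n // κ i = c} :=
      ⟨fun i => hc (Finset.mem_image.2 ⟨i.1, Finset.mem_univ _, i.2⟩)⟩
    rw [Matrix.det_isEmpty]
    exact one_ne_zero

end Blocks

/-! ### Solutions: pullback, gauge transformation, local uniqueness -/

/-- The affine coordinate of the Riemann sphere. -/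
noncomputable def OnePoint.toComplex (q : OnePoint ℂ) : ℂ := q.elim 0 id

@[simp] theorem OnePoint.toComplex_coe (z : ℂ) : OnePoint.toComplex (z : OnePoint ℂ) = z := rfl

theorem OnePoint.coe_toComplex {q : OnePoint ℂ} (h : q ≠ ∞) :
    ((OnePoint.toComplex q : ℂ) : OnePoint ℂ) = q := by
  obtain ⟨z, rfl⟩ := OnePoint.ne_infty_iff_exists.1 h
  rfl

theorem OnePoint.continuousAt_toComplex (z : ℂ) :
    ContinuousAt OnePoint.toComplex (z : OnePoint ℂ) :=
  OnePoint.continuousAt_coe.2 continuousAt_id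

section FundamentalSolutions

variable {n : ℕ} {X : Type*} [TopologicalSpace X] {p : X → OnePoint ℂ}
  {A A₁ A₂ : ℂ → Matrix (Fin n) (Fin n) ℂ} {Y : X → Matrix (Fin n) (Fin n) ℂ}

theorem IsFundamentalSolution.exists_local (hY : IsFundamentalSolution A p Y) {x : X} {z : ℂ}
    (hx : p x = (z : OnePoint ℂ)) :
    ∃ F : ℂ → Matrix (Fin n) (Fin n) ℂ,
      (∀ᶠ x' in 𝓝 x, ∀ z' : ℂ, p x' = (z' : OnePoint ℂ) → Y x' = F z') ∧ F z = Y x ∧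
        IsUnit (F z) ∧ ∀ᶠ w in 𝓝 z, HasEntryDerivAt F (A w * F w) w := by
  obtain ⟨hu, F, h1, h2⟩ := hY x z hx
  have h3 : Y x = F z := h1.self_of_nhds z hx
  exact ⟨F, h1, h3.symm, h3 ▸ hu, h2⟩

theorem IsFundamentalSolution.comp (hY : IsFundamentalSolution A p Y) {X' : Type*}
    [TopologicalSpace X'] {q : X' → OnePoint ℂ} {s : X' → X} (hs : Continuous s)
    (hq : ∀ x, p (s x) = q x) : IsFundamentalSolution A q (fun x => Y (s x)) := by
  intro x z hx
  obtain ⟨hu, F, h1, h2⟩ := hY (s x) z ((hq x).trans hx)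
  exact ⟨hu, F, (hs.tendsto x).eventually (h1.mono fun x' h z' hz' => h z' hz') |>.mono
    fun x' h z' hz' => h z' ((hq x').trans hz'), h2⟩

theorem IsOpenMap.eventually_nhds_coe (hp : IsOpenMap p) {x : X} {z : ℂ}
    (hx : p x = (z : OnePoint ℂ)) {Q : ℂ → Prop}
    (h : ∀ᶠ x' in 𝓝 x, ∀ z' : ℂ, p x' = (z' : OnePoint ℂ) → Q z') : ∀ᶠ w in 𝓝 z, Q w := by
  have h1 : ∀ᶠ q in 𝓝 (p x), ∃ x', (∀ z' : ℂ, p x' = (z' : OnePoint ℂ) → Q z') ∧ p x' = q := by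
    filter_upwards [hp.image_mem_nhds h] with q hq using hq
  rw [hx] at h1
  filter_upwards [OnePoint.continuous_coe.continuousAt.eventually h1] with w ⟨x', h2, h3⟩
  exact h2 w h3

theorem Continuous.eventually_nhds_coe (hp : Continuous p) {x : X} {z : ℂ}
    (hx : p x = (z : OnePoint ℂ)) {Q : ℂ → Prop} (h : ∀ᶠ w in 𝓝 z, Q w) :
    ∀ᶠ x' in 𝓝 x, ∀ z' : ℂ, p x' = (z' : OnePoint ℂ) → Q z' := by
  have h1 : ∀ᶠ q in 𝓝 (p x), ∀ z' : ℂ, q = (z' : OnePoint ℂ) → Q z' := by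
    rw [hx, OnePoint.nhds_coe_eq, eventually_map]
    filter_upwards [h] with w hw z' hz'
    rwa [← OnePoint.coe_injective hz']
  exact hp.continuousAt.eventually h1

/-- The product rule cancels the term `V A₁ Y`. It is applied both to the descended function `f` and
to a polynomial `V`. -/
theorem IsFundamentalSolution.gauge (hY : IsFundamentalSolution A₁ p Y)
    {V : ℂ → Matrix (Fin n) (Fin n) ℂ}
    (hV : ∀ (x : X) (z : ℂ), p x = (z : OnePoint ℂ) → IsUnit (V z) ∧
      ∀ᶠ w in 𝓝 z, HasEntryDerivAt V (A₂ w * V w - V w * A₁ w) w) :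
    IsFundamentalSolution A₂ p (fun x => V (OnePoint.toComplex (p x)) * Y x) := by
  intro x z hx
  obtain ⟨F, h1, h2, h3, h4⟩ := hY.exists_local hx
  obtain ⟨hu, hV'⟩ := hV x z hx
  refine ⟨?_, fun w => V w * F w, ?_, ?_⟩
  · change IsUnit (V (OnePoint.toComplex (p x)) * Y x)
    rw [hx, OnePoint.toComplex_coe, ← h2]
    exact hu.mul h3
  · filter_upwards [h1] with x' hx' z' hz'
    rw [hz', OnePoint.toComplex_coe, hx' z' hz']
  · filter_upwards [h4, hV'] with w hw1 hw2
    have := hw2.mul hw1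
    rwa [sub_mul, mul_assoc, mul_assoc (V w), sub_add_cancel] at this

theorem IsFundamentalSolution.eventually_inv_mul_eq (hY : IsFundamentalSolution A p Y)
    (hp : Continuous p) {Y' : X → Matrix (Fin n) (Fin n) ℂ} (hY' : IsFundamentalSolution A p Y')
    (hfin : ∀ x, p x ≠ ∞ → ∀ᶠ x' in 𝓝 x, p x' ≠ ∞) {x : X} (hx : p x ≠ ∞) :
    ∀ᶠ x' in 𝓝 x, (Y x')⁻¹ * Y' x' = (Y x)⁻¹ * Y' x := by
  obtain ⟨z, hz⟩ := OnePoint.ne_infty_iff_exists.1 hx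
  obtain ⟨F, h1, h2, h3, h4⟩ := hY.exists_local hz.symm
  obtain ⟨F', h1', h2', h3', h4'⟩ := hY'.exists_local hz.symm
  filter_upwards [h1, h1', hp.eventually_nhds_coe hz.symm (_root_.eventually_inv_mul_eq h4 h4' h3),
    hfin x hx] with x' e1 e2 e3 e4
  obtain ⟨z', hz'⟩ := OnePoint.ne_infty_iff_exists.1 e4
  rw [e1 z' hz'.symm, e2 z' hz'.symm, e3 z' hz'.symm, h2, h2']

end FundamentalSolutions

/-! ### Global uniqueness and descent away from infinity -/

section Covering

variable {m n : ℕ} {a : Fin m → ℂ} {X : Type*} [TopologicalSpace X] {ρ : X → PuncturedSphere a}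

theorem IsCoveringMap.continuous_val (hρ : IsCoveringMap ρ) : Continuous fun x => (ρ x).1 :=
  continuous_subtype_val.comp hρ.continuous

theorem IsCoveringMap.isOpenMap_val (hρ : IsCoveringMap ρ) : IsOpenMap fun x => (ρ x).1 :=
  (isOpen_puncturedSphere a).isOpenMap_subtype_val.comp hρ.isOpenMap

theorem IsCoveringMap.eventually_ne_infty (hρ : IsCoveringMap ρ) (x : X) (hx : (ρ x).1 ≠ ∞) :
    ∀ᶠ x' in 𝓝 x, (ρ x').1 ≠ ∞ :=
  hρ.continuous_val.continuousAt.eventually_ne hx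

/-- A neighbourhood of `x` is the image of a disk in the coordinate `1 / z`. Over the punctured
disk, which is connected, the locally constant `g` is constant. -/
theorem IsCoveringMap.eventually_eq_of_infty (hρ : IsCoveringMap ρ) {α : Type*} {g : X → α}
    (hg : ∀ x, (ρ x).1 ≠ ∞ → ∀ᶠ x' in 𝓝 x, g x' = g x) {x : X} (hx : (ρ x).1 = ∞) :
    ∃ c, ∀ᶠ x' in 𝓝 x, (ρ x').1 ≠ ∞ → g x' = c := by
  obtain ⟨r, hr, hrS⟩ := Metric.isOpen_iff.1
    ((isOpen_puncturedSphere a).preimage (OnePoint.continuous_ofInvCoord 0)) 0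
    (by rw [mem_preimage, OnePoint.ofInvCoord_zero, ← hx]; exact (ρ x).2)
  obtain ⟨s, hs, hs0, hsρ⟩ := hρ.exists_lift_of_convex (convex_ball (0 : ℂ) r) Metric.isOpen_ball
    (OnePoint.continuous_ofInvCoord 0).continuousOn (fun u hu => hrS hu)
    (Metric.mem_ball_self hr) (x := x) (by rw [hx, OnePoint.ofInvCoord_zero])
  have hconst : ∀ u ∈ Metric.ball (0 : ℂ) r \ {0}, ∀ v ∈ Metric.ball (0 : ℂ) r \ {0},
      g (s u) = g (s v) := by
    intro u hu v hv
    refine (isPreconnected_ball_diff_center 0 r).induction₂ (fun u v => g (s u) = g (s v))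
      (fun u hu => mem_nhdsWithin_of_mem_nhds ?_) (fun _ _ _ _ _ _ => Eq.trans)
      (fun _ _ _ _ => Eq.symm) hu hv
    have h1 : (ρ (s u)).1 ≠ ∞ := by
      rw [hsρ u hu.1, Ne, OnePoint.ofInvCoord_eq_infty_iff]
      exact hu.2
    exact ((hs.continuousAt (Metric.isOpen_ball.mem_nhds hu.1)).eventually (hg _ h1)).mono
      fun _ => Eq.symm
  have h2 := hρ.eventually_section_eq Metric.isOpen_ball (h := OnePoint.invCoord 0)
    (Metric.mem_ball_self hr) hs hsρ
    (by rw [OnePoint.ofInvCoord_zero]; exact OnePoint.continuousAt_invCoord (OnePoint.infty_ne_coe _))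
    (OnePoint.invCoord_ofInvCoord 0 0)
    (by
      rw [OnePoint.ofInvCoord_zero]
      filter_upwards [isOpen_ne.mem_nhds (OnePoint.infty_ne_coe (0 : ℂ))] with q hq
      exact OnePoint.ofInvCoord_invCoord hq)
  rw [hs0] at h2
  have hr2 : ((r / 2 : ℝ) : ℂ) ∈ Metric.ball (0 : ℂ) r \ {0} := by
    refine ⟨?_, by simpa using hr.ne'⟩
    rw [mem_ball_zero_iff, Complex.norm_real, Real.norm_of_nonneg (by positivity)]
    linarith
  refine ⟨g (s ((r / 2 : ℝ) : ℂ)), h2.mono fun x' ⟨h3, h4⟩ h5 => ?_⟩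
  rw [← h4]
  refine hconst _ ⟨h3, fun h6 => h5 ?_⟩ _ hr2
  rw [← h4, mem_singleton_iff.1 h6, hs0, hx]

/-- Removing the fibre over `∞` does not disconnect the covering surface. -/
theorem IsCoveringMap.eq_of_eventually_eq [PreconnectedSpace X] (hρ : IsCoveringMap ρ) {α : Type*}
    {g : X → α} (hg : ∀ x, (ρ x).1 ≠ ∞ → ∀ᶠ x' in 𝓝 x, g x' = g x) {x y : X}
    (hx : (ρ x).1 ≠ ∞) (hy : (ρ y).1 ≠ ∞) : g x = g y := by
  have h1 : ∀ x, ∃ c, ∀ᶠ x' in 𝓝 x, (ρ x').1 ≠ ∞ → g x' = c := fun x => by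
    by_cases hx : (ρ x).1 = ∞
    · exact hρ.eventually_eq_of_infty hg hx
    · exact ⟨g x, (hg x hx).mono fun _ h _ => h⟩
  -- `c` continues `g` across the fibre over `∞`. It is locally constant because points off that
  -- fibre are dense, `ρ` being open.
  choose c hc using h1
  have hd : ∀ x, ∃ᶠ x' in 𝓝 x, (ρ x').1 ≠ ∞ := fun x h => by
    have h2 : ∀ᶠ q in 𝓝 (ρ x).1, q = ∞ := by
      filter_upwards [hρ.isOpenMap_val.image_mem_nhds h] with q ⟨x', h3, h4⟩
      rw [← h4]
      exact not_not.1 h3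
    obtain ⟨_, h3, z, rfl⟩ := mem_closure_iff_nhds.1
      (OnePoint.denseRange_coe (X := ℂ) (ρ x).1) _ h2
    exact OnePoint.coe_ne_infty z h3
  have h2 : c x = c y := by
    refine isPreconnected_univ.induction₂ (fun x y => c x = c y) (fun x _ => ?_)
      (fun _ _ _ _ _ _ => Eq.trans) (fun _ _ _ _ => Eq.symm) (mem_univ x) (mem_univ y)
    refine mem_nhdsWithin_of_mem_nhds ?_
    filter_upwards [(hc x).eventually_nhds] with y hy
    obtain ⟨x', h3, h4, h5⟩ := ((hd y).and_eventually (hy.and (hc y))).exists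
    exact (h4 h3).symm.trans (h5 h3)
  rw [(hc x).self_of_nhds hx, (hc y).self_of_nhds hy, h2]

theorem IsFundamentalSolution.exists_eq_mul [PreconnectedSpace X] (hρ : IsCoveringMap ρ)
    {A : ℂ → Matrix (Fin n) (Fin n) ℂ} {Y Y' : X → Matrix (Fin n) (Fin n) ℂ}
    (hY : IsFundamentalSolution A (fun x => (ρ x).1) Y)
    (hY' : IsFundamentalSolution A (fun x => (ρ x).1) Y') {x₀ : X} (hx₀ : (ρ x₀).1 ≠ ∞) {x : X}
    (hx : (ρ x).1 ≠ ∞) : Y' x = Y x * ((Y x₀)⁻¹ * Y' x₀) := by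
  rw [hρ.eq_of_eventually_eq (g := fun x => (Y x)⁻¹ * Y' x) (fun x hx =>
    hY.eventually_inv_mul_eq hρ.continuous_val hY' hρ.eventually_ne_infty hx) hx₀ hx]
  obtain ⟨z, hz⟩ := OnePoint.ne_infty_iff_exists.1 hx
  rw [Matrix.mul_nonsing_inv_cancel_left _ _
    ((Matrix.isUnit_iff_isUnit_det _).1 (hY x z hz.symm).1)]

/-- Functions that are invariant under the standard deck transformations descend to the plane. -/
theorem exists_descent_plane {Γ : PositiveClosedCurve} (hΓ : Γ.PassesInOrder a)
    (hρ : IsCoveringMap ρ) (x₀ : X)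
    (hx₀ : (ρ x₀).1 ∈ Γ.inner) (σ : Fin m → X ≃ₜ X)
    (hσ : ∀ k, IsStandardDeckTransformation Γ ρ x₀ k (σ k))
    {α : Type*} (W : X → α) (hW : ∀ k x, (ρ x).1 ≠ ∞ → W (σ k x) = W x) :
    ∃ (f : ℂ → α) (G : Set X), IsOpen G ∧ x₀ ∈ G ∧
      (∀ z : ℂ, (∀ k, z ≠ a k) → ∃ x ∈ G, (ρ x).1 = (z : OnePoint ℂ)) ∧
      ∀ x ∈ G, ∀ z : ℂ, (ρ x).1 = (z : OnePoint ℂ) → f z = W x := by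
  have hne : (ρ x₀).1 ≠ ∞ := fun h =>
    disjoint_left.1 Γ.disjoint hx₀ (h ▸ Γ.infty_mem)
  rcases Nat.eq_zero_or_pos m with rfl | hm
  -- Without punctures there are no slits; a section over the whole plane takes the place of the
  -- sheets.
  · obtain ⟨z₀, hz₀⟩ := OnePoint.ne_infty_iff_exists.1 hne
    obtain ⟨s, hs, hs0, hsρ⟩ := hρ.exists_lift_of_convex convex_univ isOpen_univ
      (g := fun z => (z : OnePoint ℂ)) OnePoint.continuous_coe.continuousOn
      (fun _ _ k => k.elim0) (mem_univ z₀) hz₀.symm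
    refine ⟨fun z => W (s z), {x | (ρ x).1 ≠ ∞ ∧ s (OnePoint.toComplex (ρ x).1) = x},
      ?_, ⟨hne, ?_⟩, fun z _ => ⟨s z, ⟨?_, ?_⟩, hsρ z (mem_univ z)⟩, ?_⟩
    · rw [isOpen_iff_mem_nhds]
      rintro x ⟨hx, hsx⟩
      have h1 := hρ.eventually_section_eq isOpen_univ (h := OnePoint.toComplex)
        (mem_univ (OnePoint.toComplex (ρ x).1)) hs hsρ (OnePoint.continuousAt_toComplex _) rfl (by
          filter_upwards [isOpen_ne.mem_nhds (OnePoint.coe_ne_infty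
            (OnePoint.toComplex (ρ x).1))] with q hq using OnePoint.coe_toComplex hq)
      rw [hsx] at h1
      filter_upwards [h1, hρ.eventually_ne_infty x hx] with x' h2 h3
      exact ⟨h3, h2.2⟩
    · rw [← hz₀, OnePoint.toComplex_coe, hs0]
    · rw [hsρ z (mem_univ z)]
      exact OnePoint.coe_ne_infty z
    · rw [hsρ z (mem_univ z), OnePoint.toComplex_coe]
    · rintro x ⟨-, hx⟩ z hz
      rw [hz, OnePoint.toComplex_coe] at hx
      exact congrArg W hx
  · classical
    obtain ⟨f, G, hG, hxG, hsurj, hf⟩ := exists_descent hΓ hρ x₀ hx₀ σ hσ hm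
      -- Invariance over `∞` is not assumed, so the values there are replaced by a constant.
      (fun x => if (ρ x).1 = ∞ then W x₀ else W x) (fun k x => by
        simp only [(hσ k).1]
        split_ifs with h
        · rfl
        · exact hW k x h)
    refine ⟨fun z => f z, G, hG, hxG, fun z hz => hsurj z fun k h =>
      hz k (OnePoint.coe_injective h), fun x hx z hz => ?_⟩
    have := hf x hx
    rwa [hz, if_neg (OnePoint.coe_ne_infty z)] at this

end Covering

/-! ### The transition function and its local behaviour -/

section Transition

variable {m n : ℕ} {a : Fin m → ℂ} {X : Type*} [TopologicalSpace X] {ρ : X → PuncturedSphere a}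

/-- `IsCoveringMap` allows empty fibres; surjectivity over the plane comes from the descent of a
trivial function. -/
theorem exists_fiber_point {Γ : PositiveClosedCurve} (hΓ : Γ.PassesInOrder a)
    (hρ : IsCoveringMap ρ) {x₀ : X}
    (hx₀ : (ρ x₀).1 ∈ Γ.inner) {σ : Fin m → X ≃ₜ X}
    (hσ : ∀ k, IsStandardDeckTransformation Γ ρ x₀ k (σ k)) {z : ℂ} (hz : ∀ k, z ≠ a k) :
    ∃ x, (ρ x).1 = (z : OnePoint ℂ) := by
  obtain ⟨-, G, -, -, h, -⟩ := exists_descent_plane hΓ hρ x₀ hx₀ σ hσ (fun _ => ()) (by simp)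
  obtain ⟨x, -, hx⟩ := h z hz
  exact ⟨x, hx⟩

theorem ne_of_coe_eq {q : PuncturedSphere a} {z : ℂ} (hz : q.1 = (z : OnePoint ℂ)) (k : Fin m) :
    z ≠ a k :=
  fun h => q.2 k (by rw [hz, h])

/-- `C₂ C₁⁻¹` intertwines the two monodromies, both being conjugate to the same `M`. -/
theorem IsStandardForm.exists_monodromy_invariant {σ : Fin m → X ≃ₜ X} {ρ : X → PuncturedSphere a}
    {M E : Fin m → Matrix (Fin n) (Fin n) ℂ} {κ₁ κ₂ : Fin n → ℤ}
    {A₁ A₂ : ℂ → Matrix (Fin n) (Fin n) ℂ}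
    (h₁ : IsStandardForm ρ σ M E κ₁ A₁) (h₂ : IsStandardForm ρ σ M E κ₂ A₂)
    {Y₁ Y₂ : X → Matrix (Fin n) (Fin n) ℂ}
    (hY₁ : IsFundamentalSolution A₁ (fun x => (ρ x).1) Y₁)
    (hY₂ : IsFundamentalSolution A₂ (fun x => (ρ x).1) Y₂) :
    ∃ C : GL (Fin n) ℂ, ∀ k x, (ρ x).1 ≠ ∞ →
      Y₂ (σ k x) * (C : Matrix (Fin n) (Fin n) ℂ) * (Y₁ (σ k x))⁻¹ = Y₂ x * C * (Y₁ x)⁻¹ := by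
  obtain ⟨χ₁, hχ₁, C₁, hC₁⟩ := h₁.monodromy Y₁ hY₁
  obtain ⟨χ₂, hχ₂, C₂, hC₂⟩ := h₂.monodromy Y₂ hY₂
  refine ⟨C₂ * C₁⁻¹, fun k x hx => ?_⟩
  have h3 : C₁⁻¹ * χ₁ k * C₁ = C₂⁻¹ * χ₂ k * C₂ := Units.ext ((hC₁ k).symm.trans (hC₂ k))
  have h4 : χ₂ k * (C₂ * C₁⁻¹) = C₂ * C₁⁻¹ * χ₁ k := by
    calc χ₂ k * (C₂ * C₁⁻¹) = C₂ * (C₂⁻¹ * χ₂ k * C₂) * C₁⁻¹ := by group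
      _ = C₂ * C₁⁻¹ * χ₁ k := by rw [← h3]; group
  generalize C₂ * C₁⁻¹ = D at h4
  have h5 : (χ₂ k : Matrix (Fin n) (Fin n) ℂ) * (D : Matrix (Fin n) (Fin n) ℂ) =
      (D : Matrix (Fin n) (Fin n) ℂ) * (χ₁ k : Matrix (Fin n) (Fin n) ℂ) := congrArg Units.val h4
  rw [hχ₁ k x hx, hχ₂ k x hx, Matrix.mul_inv_rev,
    mul_assoc (Y₂ _) (χ₂ k : Matrix (Fin n) (Fin n) ℂ), h5]
  simp only [mul_assoc]
  rw [← mul_assoc (χ₁ k : Matrix (Fin n) (Fin n) ℂ), ← Matrix.coe_units_inv, Units.mul_inv,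
    one_mul]

theorem IsStandardForm.exists_transition {Γ : PositiveClosedCurve} (hΓ : Γ.PassesInOrder a)
    [PreconnectedSpace X] (hρ : IsCoveringMap ρ) {x₀ : X}
    (hx₀ : (ρ x₀).1 ∈ Γ.inner) {σ : Fin m → X ≃ₜ X}
    (hσ : ∀ k, IsStandardDeckTransformation Γ ρ x₀ k (σ k))
    {M E : Fin m → Matrix (Fin n) (Fin n) ℂ} {κ₁ κ₂ : Fin n → ℤ}
    {A₁ A₂ : ℂ → Matrix (Fin n) (Fin n) ℂ}
    (h₁ : IsStandardForm ρ σ M E κ₁ A₁) (h₂ : IsStandardForm ρ σ M E κ₂ A₂)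
    {Y₁ Y₂ : X → Matrix (Fin n) (Fin n) ℂ}
    (hY₁ : IsFundamentalSolution A₁ (fun x => (ρ x).1) Y₁)
    (hY₂ : IsFundamentalSolution A₂ (fun x => (ρ x).1) Y₂) :
    ∃ (f : ℂ → Matrix (Fin n) (Fin n) ℂ) (C : GL (Fin n) ℂ),
      (∀ z, (∀ k, z ≠ a k) → IsUnit (f z) ∧
        ∀ᶠ w in 𝓝 z, HasEntryDerivAt f (A₂ w * f w - f w * A₁ w) w) ∧
      ∀ (x : X) (z : ℂ), (ρ x).1 = (z : OnePoint ℂ) →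
        f z * Y₁ x = Y₂ x * (C : Matrix (Fin n) (Fin n) ℂ) := by
  obtain ⟨C, hC⟩ := h₁.exists_monodromy_invariant h₂ hY₁ hY₂
  obtain ⟨f, G, hG, hxG, hsurj, hf⟩ := exists_descent_plane hΓ hρ x₀ hx₀ σ hσ
    (fun x => Y₂ x * (C : Matrix (Fin n) (Fin n) ℂ) * (Y₁ x)⁻¹) hC
  have hf' : ∀ z, (∀ k, z ≠ a k) → IsUnit (f z) ∧
      ∀ᶠ w in 𝓝 z, HasEntryDerivAt f (A₂ w * f w - f w * A₁ w) w := by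
    intro z hz
    obtain ⟨x, hxG, hx⟩ := hsurj z hz
    obtain ⟨F₁, e1, e2, e3, e4⟩ := hY₁.exists_local hx
    obtain ⟨F₂, d1, d2, d3, d4⟩ := hY₂.exists_local hx
    have hfF : ∀ᶠ w in 𝓝 z, f w = F₂ w * (C : Matrix (Fin n) (Fin n) ℂ) * (F₁ w)⁻¹ := by
      refine hρ.isOpenMap_val.eventually_nhds_coe hx ?_
      filter_upwards [e1, d1, hG.mem_nhds hxG] with x' h3 h4 h5 z' hz'
      rw [hf x' h5 z' hz', h3 z' hz', h4 z' hz']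
    refine ⟨?_, ?_⟩
    · rw [hfF.self_of_nhds]
      exact (d3.mul C.isUnit).mul (Matrix.isUnit_nonsing_inv_iff.2 e3)
    · filter_upwards [hfF.eventually_nhds, e4, d4,
        e4.self_of_nhds.continuousAt.eventually_isUnit_matrix e3] with w h3 h4 h5 h6
      have h7 := ((h5.mul_const (C : Matrix (Fin n) (Fin n) ℂ)).mul (h4.inv h6)).congr h3
      convert h7 using 1
      rw [h3.self_of_nhds, mul_assoc (F₁ w)⁻¹, mul_assoc (A₁ w), Matrix.mul_nonsing_inv _
        ((Matrix.isUnit_iff_isUnit_det _).1 h6)]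
      noncomm_ring
  refine ⟨f, C, hf', fun x z hx => ?_⟩
  -- `f Y₁` and `Y₂` solve the same system on all of `X`. The constant relating them is evaluated at
  -- `x₀ ∈ G`, where `f` is known to be `Y₂ C Y₁⁻¹`.
  have hg : IsFundamentalSolution A₂ (fun x => (ρ x).1)
      (fun x => f (OnePoint.toComplex (ρ x).1) * Y₁ x) :=
    hY₁.gauge fun x z hz => hf' z (ne_of_coe_eq hz)
  have hne : (ρ x₀).1 ≠ ∞ := fun h => disjoint_left.1 Γ.disjoint hx₀ (h ▸ Γ.infty_mem)
  obtain ⟨z₀, hz₀⟩ := OnePoint.ne_infty_iff_exists.1 hne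
  have h3 := hY₂.exists_eq_mul hρ hg hne (x := x) (by rw [hx]; exact OnePoint.coe_ne_infty z)
  simp only [hx, ← hz₀, OnePoint.toComplex_coe, hf x₀ hxG z₀ hz₀.symm] at h3
  rw [h3, Matrix.nonsing_inv_mul_cancel_right _ _
    ((Matrix.isUnit_iff_isUnit_det _).1 (hY₁ x₀ z₀ hz₀.symm).1),
    Matrix.nonsing_inv_mul_cancel_left _ _
    ((Matrix.isUnit_iff_isUnit_det _).1 (hY₂ x₀ z₀ hz₀.symm).1)]

theorem eq_mul_nonsing_inv_of_mul_eq {B C D : Matrix (Fin n) (Fin n) ℂ} (hD : IsUnit D)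
    (h : B * D = C) : B = C * D⁻¹ := by
  rw [← h, Matrix.mul_nonsing_inv_cancel_right _ _ ((Matrix.isUnit_iff_isUnit_det _).1 hD)]

/-- The transition function continues analytically to the singularities. -/
theorem IsStandardForm.exists_extension {Γ : PositiveClosedCurve} (hΓ : Γ.PassesInOrder a)
    (hρ : IsCoveringMap ρ) {x₀ : X}
    (hx₀ : (ρ x₀).1 ∈ Γ.inner) {σ : Fin m → X ≃ₜ X}
    (hσ : ∀ k, IsStandardDeckTransformation Γ ρ x₀ k (σ k))
    {M E : Fin m → Matrix (Fin n) (Fin n) ℂ} {κ₁ κ₂ : Fin n → ℤ}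
    {A₁ A₂ : ℂ → Matrix (Fin n) (Fin n) ℂ}
    (h₁ : IsStandardForm ρ σ M E κ₁ A₁) (h₂ : IsStandardForm ρ σ M E κ₂ A₂)
    {Y₁ Y₂ : X → Matrix (Fin n) (Fin n) ℂ}
    (hY₁ : IsFundamentalSolution A₁ (fun x => (ρ x).1) Y₁)
    (hY₂ : IsFundamentalSolution A₂ (fun x => (ρ x).1) Y₂)
    {f : ℂ → Matrix (Fin n) (Fin n) ℂ} {C : GL (Fin n) ℂ}
    (hf : ∀ (x : X) (z : ℂ), (ρ x).1 = (z : OnePoint ℂ) →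
        f z * Y₁ x = Y₂ x * (C : Matrix (Fin n) (Fin n) ℂ))
    {k : Fin m} (hE : IsNonResonant (E k)) :
    ∃ δ > 0, (∀ j, j ≠ k → δ ≤ dist (a j) (a k)) ∧ ∃ H : ℂ → Matrix (Fin n) (Fin n) ℂ,
      IsAnalyticInvertibleOn H (Metric.ball (a k) δ) ∧
      ∀ z ∈ Metric.ball (a k) δ, z ≠ a k → f z = H z := by
  obtain ⟨ε₁, hε₁, hd₁, hU₁⟩ := h₁.local_form k
  obtain ⟨ε₂, hε₂, hd₂, hU₂⟩ := h₂.local_form k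
  have hε : 0 < max ε₁ ε₂ := lt_max_of_lt_left hε₁
  have hlog : ∀ {ε : ℝ} {w : ℂ}, 0 < ε → (w.re < Real.log ε ↔ ‖Complex.exp w‖ < ε) :=
    fun hε => by rw [Complex.norm_exp, Real.lt_log_iff_exp_lt hε]
  have hne : ∀ w : ℂ, w.re < Real.log (max ε₁ ε₂) → ∀ j, a k + Complex.exp w ≠ a j := by
    intro w hw j h
    by_cases hj : j = k
    · subst hj
      exact Complex.exp_ne_zero w (add_eq_left.1 h)
    · have h3 : dist (a j) (a k) = ‖Complex.exp w‖ := by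
        rw [← h, dist_eq_norm, add_sub_cancel_left]
      exact ((hlog hε).1 hw).not_ge (h3 ▸ max_le (hd₁ j hj) (hd₂ j hj))
  let w₀ : ℂ := ((Real.log (max ε₁ ε₂) - 1 : ℝ) : ℂ)
  have hw₀ : w₀ ∈ {w : ℂ | w.re < Real.log (max ε₁ ε₂)} := by
    change w₀.re < _
    simp only [w₀, Complex.ofReal_re]
    linarith
  obtain ⟨x, hx⟩ := exists_fiber_point hΓ hρ hx₀ hσ (hne w₀ hw₀)
  -- One lift over the larger of the two half-planes serves both local forms, so that they are
  -- compared on the same sheet.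
  obtain ⟨s, hs, -, hsρ⟩ := hρ.exists_lift_of_convex
    (convex_halfSpace_re_lt (Real.log (max ε₁ ε₂))) (isOpen_lt Complex.continuous_re continuous_const)
    (g := fun w => ((a k + Complex.exp w : ℂ) : OnePoint ℂ))
    (OnePoint.continuous_coe.comp (by fun_prop)).continuousOn
    (fun w hw j h => hne w hw j (OnePoint.coe_injective h)) hw₀ hx
  have hpull : ∀ {ε : ℝ}, 0 < ε → ε ≤ max ε₁ ε₂ → ∀ {A : ℂ → Matrix (Fin n) (Fin n) ℂ}
      {Y : X → Matrix (Fin n) (Fin n) ℂ}, IsFundamentalSolution A (fun x => (ρ x).1) Y →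
      IsFundamentalSolution A (fun w : LogDisk ε => ((a k + Complex.exp w.1 : ℂ) : OnePoint ℂ))
        (fun w => Y (s w.1)) := by
    intro ε hε0 hε' A Y hY
    have hsub : ∀ w : LogDisk ε, w.1 ∈ {w : ℂ | w.re < Real.log (max ε₁ ε₂)} := fun w =>
      w.2.trans_le (Real.log_le_log hε0 hε')
    exact hY.comp (s := fun w : LogDisk ε => s w.1)
      (hs.comp_continuous continuous_subtype_val hsub) fun w => hsρ _ (hsub w)
  obtain ⟨Z₁, C₁, hZ₁, hYZ₁⟩ := hU₁ _ (hpull hε₁ (le_max_left _ _) hY₁)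
  obtain ⟨Z₂, C₂, hZ₂, hYZ₂⟩ := hU₂ _ (hpull hε₂ (le_max_right _ _) hY₂)
  have hδ : 0 < min ε₁ ε₂ := lt_min hε₁ hε₂
  let B : Matrix (Fin n) (Fin n) ℂ := ((C₂ * C * C₁⁻¹ : GL (Fin n) ℂ) : Matrix (Fin n) (Fin n) ℂ)
  have hB : IsUnit B := (C₂ * C * C₁⁻¹ : GL (Fin n) ℂ).isUnit
  have key : ∀ w : ℂ, w.re < Real.log (min ε₁ ε₂) →
      f (a k + Complex.exp w) * Z₁ (a k + Complex.exp w) * NormedSpace.exp (w • E k) =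
      Z₂ (a k + Complex.exp w) * NormedSpace.exp (w • E k) * B := by
    intro w hw
    have hw₁ := hw.trans_le (Real.log_le_log hδ (min_le_left ε₁ ε₂))
    have hw₂ := hw.trans_le (Real.log_le_log hδ (min_le_right ε₁ ε₂))
    have h3 := hf (s w) _ (hsρ w (hw₁.trans_le (Real.log_le_log hε₁ (le_max_left _ _))))
    rw [show Y₁ (s w) = _ from hYZ₁ ⟨w, hw₁⟩, show Y₂ (s w) = _ from hYZ₂ ⟨w, hw₂⟩] at h3
    simp only [← mul_assoc] at h3
    simp only [B, Units.val_mul, ← mul_assoc]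
    rw [← h3, mul_assoc _ (C₁ : Matrix (Fin n) (Fin n) ℂ), ← Units.val_mul, mul_inv_cancel,
      Units.val_one, mul_one]
  have hmem : ∀ w : ℂ, w.re < Real.log (min ε₁ ε₂) →
      a k + Complex.exp w ∈ Metric.ball (a k) (min ε₁ ε₂) := fun w hw => by
    rw [Metric.mem_ball, dist_eq_norm, add_sub_cancel_left]
    exact (hlog hδ).1 hw
  have hZ₁' := hZ₁.mono (Metric.ball_subset_ball (min_le_left ε₁ ε₂))
  have hZ₂' := hZ₂.mono (Metric.ball_subset_ball (min_le_right ε₁ ε₂))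
  have hcomm : Commute (E k) B := by
    refine hE.commute ?_
    obtain ⟨w, hw⟩ : ∃ w : ℂ, w.re < Real.log (min ε₁ ε₂) :=
      ⟨((Real.log (min ε₁ ε₂) - 1 : ℝ) : ℂ), by simp⟩
    have h3 := key w hw
    -- The same point `z` is reached with the logarithm increased by `2πi`; comparing the two
    -- identities shows that `B` commutes with `exp(2πiE)`.
    have h4 := key (w + 2 * Real.pi * Complex.I) (by simpa using hw)
    have h5 : NormedSpace.exp ((w + 2 * Real.pi * Complex.I) • E k) =
        NormedSpace.exp (w • E k) * NormedSpace.exp ((2 * Real.pi * Complex.I : ℂ) • E k) := by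
      rw [add_smul, Matrix.exp_add_of_commute]
      exact ((Commute.refl (E k)).smul_left w).smul_right _
    rw [Complex.exp_periodic w, h5, ← mul_assoc, h3] at h4
    have h6 : IsUnit (Z₂ (a k + Complex.exp w) * NormedSpace.exp (w • E k)) :=
      (hZ₂' _ (hmem w hw)).1.mul (Matrix.isUnit_exp _)
    refine h6.mul_left_cancel ?_
    simpa only [mul_assoc] using h4
  refine ⟨min ε₁ ε₂, hδ, fun j hj => (min_le_left _ _).trans (hd₁ j hj),
    fun z => Z₂ z * B * (Z₁ z)⁻¹,
    (hZ₂'.mul (isAnalyticInvertibleOn_const hB _)).mul hZ₁'.inv, fun z hz hzk => ?_⟩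
  have hz0 : z - a k ≠ 0 := sub_ne_zero.2 hzk
  have hzw : a k + Complex.exp (Complex.log (z - a k)) = z := by
    rw [Complex.exp_log hz0, add_sub_cancel]
  have hw : (Complex.log (z - a k)).re < Real.log (min ε₁ ε₂) := by
    rw [hlog hδ, Complex.exp_log hz0, ← dist_eq_norm]
    exact hz
  have h3 := key _ hw
  rw [hzw, mul_assoc (Z₂ z), ((hcomm.smul_left _).exp_left).eq, ← mul_assoc] at h3
  exact eq_mul_nonsing_inv_of_mul_eq (hZ₁' z hz).1 ((Matrix.isUnit_exp _).mul_right_cancel h3)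

/-- The shape of the transition function near `∞`. -/
theorem IsStandardForm.exists_at_infinity {Γ : PositiveClosedCurve} (hΓ : Γ.PassesInOrder a)
    (hρ : IsCoveringMap ρ) {x₀ : X}
    (hx₀ : (ρ x₀).1 ∈ Γ.inner) {σ : Fin m → X ≃ₜ X}
    (hσ : ∀ k, IsStandardDeckTransformation Γ ρ x₀ k (σ k))
    {M E : Fin m → Matrix (Fin n) (Fin n) ℂ} {κ₁ κ₂ : Fin n → ℤ}
    {A₁ A₂ : ℂ → Matrix (Fin n) (Fin n) ℂ}
    (h₁ : IsStandardForm ρ σ M E κ₁ A₁) (h₂ : IsStandardForm ρ σ M E κ₂ A₂)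
    {Y₁ Y₂ : X → Matrix (Fin n) (Fin n) ℂ}
    (hY₁ : IsFundamentalSolution A₁ (fun x => (ρ x).1) Y₁)
    (hY₂ : IsFundamentalSolution A₂ (fun x => (ρ x).1) Y₂)
    {f : ℂ → Matrix (Fin n) (Fin n) ℂ} {C : GL (Fin n) ℂ}
    (hf : ∀ (x : X) (z : ℂ), (ρ x).1 = (z : OnePoint ℂ) →
        f z * Y₁ x = Y₂ x * (C : Matrix (Fin n) (Fin n) ℂ)) :
    ∃ R > 0, (∀ j, ‖a j‖ ≤ R) ∧ ∃ H : ℂ → Matrix (Fin n) (Fin n) ℂ,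
      IsAnalyticInvertibleOn H (Metric.ball 0 R⁻¹) ∧
      ∀ z, R < ‖z‖ → ∀ i j, f z i j * z ^ κ₁ j = z ^ κ₂ i * H z⁻¹ i j := by
  obtain ⟨R₁, hR₁, ha₁, hU₁⟩ := h₁.infinity_form
  obtain ⟨R₂, hR₂, ha₂, hU₂⟩ := h₂.infinity_form
  have hr : 0 < min R₁ R₂ := lt_min hR₁ hR₂
  have hne : ∀ z : ℂ, min R₁ R₂ < ‖z‖ → ∀ j, z ≠ a j := by
    rintro z hz j rfl
    exact hz.not_ge (le_min (ha₁ j) (ha₂ j))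
  have hinv : ∀ {R : ℝ} {z : ℂ}, 0 < R → R < ‖z‖ → z⁻¹ ∈ Metric.ball (0 : ℂ) R⁻¹ := by
    intro R z hR hz
    rw [mem_ball_zero_iff, norm_inv]
    exact inv_strictAnti₀ hR hz
  have hcoe : ∀ {z : ℂ}, min R₁ R₂ < ‖z‖ → OnePoint.ofInvCoord 0 z⁻¹ = (z : OnePoint ℂ) := by
    intro z hz
    have hz0 : z ≠ 0 := norm_pos_iff.1 (hr.trans hz)
    rw [OnePoint.ofInvCoord_of_ne (inv_ne_zero hz0), inv_inv, zero_add]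
  let z₀ : ℂ := ((min R₁ R₂ + 1 : ℝ) : ℂ)
  have hz₀ : min R₁ R₂ < ‖z₀‖ := by
    rw [Complex.norm_real, Real.norm_of_nonneg (by linarith)]
    linarith
  obtain ⟨x, hx⟩ := exists_fiber_point hΓ hρ hx₀ hσ (hne z₀ hz₀)
  -- The lift is taken in `ζ = 1 / z` over a full disk including `∞`, so solutions pull back to
  -- single-valued functions of `z`. The minimum of the radii gives an exterior domain containing
  -- both.
  obtain ⟨s, hs, -, hsρ⟩ := hρ.exists_lift_of_convex (convex_ball (0 : ℂ) (min R₁ R₂)⁻¹)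
    Metric.isOpen_ball (OnePoint.continuous_ofInvCoord 0).continuousOn
    (fun ζ hζ j h => by
      by_cases h0 : ζ = 0
      · rw [h0, OnePoint.ofInvCoord_zero] at h
        exact OnePoint.infty_ne_coe _ h
      · rw [OnePoint.ofInvCoord_of_ne h0, zero_add] at h
        refine hne ζ⁻¹ ?_ j (OnePoint.coe_injective h)
        rw [mem_ball_zero_iff] at hζ
        rw [norm_inv]
        exact (lt_inv_comm₀ (norm_pos_iff.2 h0) hr).1 hζ)
    (hinv hr hz₀) (hx.trans (hcoe hz₀).symm)
  have hsρ' : ∀ {z : ℂ}, min R₁ R₂ < ‖z‖ → (ρ (s z⁻¹)).1 = (z : OnePoint ℂ) := fun hz =>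
    (hsρ _ (hinv hr hz)).trans (hcoe hz)
  have hpull : ∀ {R : ℝ}, 0 < R → min R₁ R₂ ≤ R → ∀ {A : ℂ → Matrix (Fin n) (Fin n) ℂ}
      {Y : X → Matrix (Fin n) (Fin n) ℂ}, IsFundamentalSolution A (fun x => (ρ x).1) Y →
      IsFundamentalSolution A (fun z : PuncturedNhdInfty R => (z.1 : OnePoint ℂ))
        (fun z => Y (s z.1⁻¹)) := by
    intro R hR0 hR A Y hY
    refine hY.comp (s := fun z : PuncturedNhdInfty R => s z.1⁻¹)
      (hs.comp_continuous ?_ fun z => hinv hr (hR.trans_lt z.2)) fun z => hsρ' (hR.trans_lt z.2)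
    exact continuous_subtype_val.inv₀ fun z => norm_pos_iff.1 (hR0.trans z.2)
  obtain ⟨G₁, C₁, hG₁, hYG₁⟩ := hU₁ _ (hpull hR₁ (min_le_left _ _) hY₁)
  obtain ⟨G₂, C₂, hG₂, hYG₂⟩ := hU₂ _ (hpull hR₂ (min_le_right _ _) hY₂)
  let B : Matrix (Fin n) (Fin n) ℂ := ((C₂ * C * C₁⁻¹ : GL (Fin n) ℂ) : Matrix (Fin n) (Fin n) ℂ)
  have hB : IsUnit B := (C₂ * C * C₁⁻¹ : GL (Fin n) ℂ).isUnit
  have hR : 0 < max R₁ R₂ := lt_max_of_lt_left hR₁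
  have hG₁' := hG₁.mono (Metric.ball_subset_ball (inv_anti₀ hR₁ (le_max_left R₁ R₂)))
  have hG₂' := hG₂.mono (Metric.ball_subset_ball (inv_anti₀ hR₂ (le_max_right R₁ R₂)))
  refine ⟨max R₁ R₂, hR, fun j => le_max_of_le_left (ha₁ j), fun ζ => G₂ ζ * B * (G₁ ζ)⁻¹,
    (hG₂'.mul (isAnalyticInvertibleOn_const hB _)).mul hG₁'.inv, fun z hz i j => ?_⟩
  have hz₁ := (le_max_left R₁ R₂).trans_lt hz
  have hz₂ := (le_max_right R₁ R₂).trans_lt hz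
  have h3 := hf (s z⁻¹) z (hsρ' ((min_le_left R₁ R₂).trans_lt hz₁))
  rw [show Y₁ (s z⁻¹) = _ from hYG₁ ⟨z, hz₁⟩, show Y₂ (s z⁻¹) = _ from hYG₂ ⟨z, hz₂⟩] at h3
  simp only [← mul_assoc] at h3
  have h4 : f z * Matrix.diagonal (fun i => z ^ κ₁ i) * G₁ z⁻¹ =
      Matrix.diagonal (fun i => z ^ κ₂ i) * G₂ z⁻¹ * B := by
    simp only [B, Units.val_mul, ← mul_assoc]
    rw [← h3, mul_assoc _ (C₁ : Matrix (Fin n) (Fin n) ℂ), ← Units.val_mul, mul_inv_cancel,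
      Units.val_one, mul_one]
  have h5 := eq_mul_nonsing_inv_of_mul_eq (hG₁' _ (hinv hR hz)).1 h4
  rw [mul_assoc (Matrix.diagonal _), mul_assoc (Matrix.diagonal _)] at h5
  have h6 := congrFun (congrFun h5 i) j
  rwa [Matrix.mul_diagonal, Matrix.diagonal_mul] at h6

end Transition

/-! ### From the transition function to a matrix polynomial -/

section Polynomials

variable {m n : ℕ}

theorem isOpen_forall_ne (a : Fin m → ℂ) : IsOpen {z : ℂ | ∀ k, z ≠ a k} := by
  rw [ofPred_forall]
  exact isOpen_iInter_of_finite fun k => isOpen_ne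

/-- A transition function that extends to the singularities and has moderate growth at `∞` is
given by a matrix polynomial. -/
theorem exists_evalMatrix_eq {a : Fin m → ℂ} {f : ℂ → Matrix (Fin n) (Fin n) ℂ}
    (hf : IsAnalyticInvertibleOn f {z | ∀ k, z ≠ a k})
    (hfa : ∀ k, ∃ δ > 0, (∀ j, j ≠ k → δ ≤ dist (a j) (a k)) ∧
      ∃ H : ℂ → Matrix (Fin n) (Fin n) ℂ, IsAnalyticInvertibleOn H (Metric.ball (a k) δ) ∧
        ∀ z ∈ Metric.ball (a k) δ, z ≠ a k → f z = H z)
    {κ₁ κ₂ : Fin n → ℤ}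
    (hfi : ∃ R > 0, (∀ j, ‖a j‖ ≤ R) ∧ ∃ H : ℂ → Matrix (Fin n) (Fin n) ℂ,
      IsAnalyticInvertibleOn H (Metric.ball 0 R⁻¹) ∧
      ∀ z, R < ‖z‖ → ∀ i j, f z i j * z ^ κ₁ j = z ^ κ₂ i * H z⁻¹ i j) :
    ∃ V : Matrix (Fin n) (Fin n) (Polynomial ℂ),
      (∀ i j, κ₂ i < κ₁ j → V i j = 0) ∧
      (∀ i j, κ₁ j ≤ κ₂ i → ((V i j).natDegree : ℤ) ≤ κ₂ i - κ₁ j) ∧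
      (∀ z, IsUnit (evalMatrix V z)) ∧ ∀ z, (∀ k, z ≠ a k) → evalMatrix V z = f z := by
  classical
  choose δ hδ hd H hH hfH using hfa
  -- Each ball of radius `δ k` contains no other puncture, so `g` coincides with `H k` on all of it,
  -- whichever index `choose` returns.
  let g : ℂ → Matrix (Fin n) (Fin n) ℂ := fun z => if h : ∃ k, z = a k then H h.choose z else f z
  have hgf : ∀ z, (∀ k, z ≠ a k) → g z = f z := fun z hz => dif_neg (by simpa using hz)
  have hgH : ∀ k, ∀ z ∈ Metric.ball (a k) (δ k), g z = H k z := by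
    intro k z hz
    have hjk : ∀ j, z = a j → j = k := by
      rintro j rfl
      by_contra hj
      exact (hd k j hj).not_gt hz
    by_cases h : ∃ j, z = a j
    · rw [show g z = H h.choose z from dif_pos h, hjk _ h.choose_spec]
    · rw [hgf z (by simpa using h)]
      exact hfH k z hz fun h' => h ⟨k, h'⟩
  have hg : IsAnalyticInvertibleOn g univ := by
    have hcongr : ∀ {F : ℂ → Matrix (Fin n) (Fin n) ℂ} {U : Set ℂ} {z : ℂ},
        IsAnalyticInvertibleOn F U → IsOpen U → z ∈ U → (∀ w ∈ U, g w = F w) →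
        IsUnit (g z) ∧ ∀ i j, AnalyticAt ℂ (fun w => g w i j) z := by
      intro F U z hF hU hz h
      refine ⟨by rw [h z hz]; exact (hF z hz).1, fun i j => ((hF z hz).2 i j).congr ?_⟩
      filter_upwards [hU.mem_nhds hz] with w hw
      rw [h w hw]
    intro z _
    by_cases h : ∃ k, z = a k
    · obtain ⟨k, rfl⟩ := h
      exact hcongr (hH k) Metric.isOpen_ball (Metric.mem_ball_self (hδ k)) (hgH k)
    · exact hcongr hf (isOpen_forall_ne a) (by simpa using h) hgf
  obtain ⟨R, hR, haR, G, hG, hfG⟩ := hfi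
  have hgrowth : ∀ i j, ∃ K R', ∀ z, R' < ‖z‖ → ‖g z i j‖ ≤ K * ‖z‖ ^ (κ₂ i - κ₁ j) := by
    intro i j
    have hc : ContinuousAt (fun ζ => G ζ i j) 0 :=
      ((hG 0 (Metric.mem_ball_self (inv_pos.2 hR))).2 i j).continuousAt
    obtain ⟨r, hr, hrG⟩ := Metric.eventually_nhds_iff_ball.1
      (hc.norm.eventually_le_const (lt_add_one ‖G 0 i j‖))
    refine ⟨‖G 0 i j‖ + 1, max R r⁻¹, fun z hz => ?_⟩
    have hzR : R < ‖z‖ := (le_max_left _ _).trans_lt hz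
    have hzr : r⁻¹ < ‖z‖ := (le_max_right _ _).trans_lt hz
    have hz0 : 0 < ‖z‖ := hR.trans hzR
    have h1 := hrG z⁻¹ (by
      rw [mem_ball_zero_iff, norm_inv]
      exact (inv_lt_comm₀ hr hz0).1 hzr)
    rw [hgf z (by rintro k rfl; exact hzR.not_ge (haR k))]
    have h2 := congrArg norm (hfG z hzR i j)
    rw [norm_mul, norm_mul, norm_zpow, norm_zpow] at h2
    rw [zpow_sub₀ hz0.ne', mul_div_assoc', le_div_iff₀ (zpow_pos hz0 _), h2, mul_comm]
    gcongr
  have hdiff : ∀ i j, Differentiable ℂ fun z => g z i j := fun i j z =>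
    ((hg z (mem_univ z)).2 i j).differentiableAt
  have hpoly : ∀ i j, ∃ p : Polynomial ℂ, (κ₂ i < κ₁ j → p = 0) ∧
      (κ₁ j ≤ κ₂ i → (p.natDegree : ℤ) ≤ κ₂ i - κ₁ j) ∧ ∀ z, g z i j = p.eval z := by
    intro i j
    obtain ⟨K, R', hK⟩ := hgrowth i j
    rcases lt_or_ge (κ₂ i) (κ₁ j) with h | h
    · refine ⟨0, fun _ => rfl, fun h' => (h.not_ge h').elim, fun z => ?_⟩
      rw [(hdiff i j).eq_zero_of_norm_le_zpow (by omega) hK z, Polynomial.eval_zero]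
    · have hN : ((κ₂ i - κ₁ j).toNat : ℤ) = κ₂ i - κ₁ j := Int.toNat_of_nonneg (by omega)
      obtain ⟨p, hp, hpe⟩ := (hdiff i j).exists_polynomial_of_norm_le_pow (κ₂ i - κ₁ j).toNat
        (K := K) (R := R') (fun z hz => by
          rw [← zpow_natCast, hN]
          exact hK z hz)
      exact ⟨p, fun h' => (h.not_gt h').elim, fun _ => by omega, hpe⟩
  choose V hV0 hVd hVe using hpoly
  have hVg : ∀ z, evalMatrix (Matrix.of V) z = g z := fun z => by
    ext i j
    exact (hVe i j z).symm
  exact ⟨Matrix.of V, hV0, hVd, fun z => by rw [hVg]; exact (hg z (mem_univ z)).1,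
    fun z hz => by rw [hVg, hgf z hz]⟩

theorem hasEntryDerivAt_evalMatrix (V : Matrix (Fin n) (Fin n) (Polynomial ℂ)) (z : ℂ) :
    HasEntryDerivAt (evalMatrix V) (evalMatrix (V.map Polynomial.derivative) z) z :=
  fun i j => (V i j).hasDerivAt z

/-- Multiplying by `V` on the right turns (1) into the differential equation satisfied by the
transition function. -/
theorem coefficientsRelated_iff {a : Fin m → ℂ} {A₁ A₂ : ℂ → Matrix (Fin n) (Fin n) ℂ}
    {V : Matrix (Fin n) (Fin n) (Polynomial ℂ)} (hV : ∀ z, IsUnit (evalMatrix V z)) :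
    CoefficientsRelated a A₁ A₂ V ↔ ∀ z, (∀ k, z ≠ a k) →
      evalMatrix (V.map Polynomial.derivative) z = A₂ z * evalMatrix V z - evalMatrix V z * A₁ z := by
  refine forall_congr' fun z => imp_congr_right fun _ => ?_
  rw [← add_mul, eq_sub_iff_add_eq]
  refine ⟨fun h => ?_, fun h => eq_mul_nonsing_inv_of_mul_eq (hV z) h.symm⟩
  rw [h, Matrix.nonsing_inv_mul_cancel_right _ _ ((Matrix.isUnit_iff_isUnit_det _).1 (hV z))]

end Polynomials

/-! ### The theorem -/

section Main

variable {m n : ℕ} {a : Fin m → ℂ} {X : Type*} [TopologicalSpace X] {ρ : X → PuncturedSphere a}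

theorem IsStandardForm.exists_polynomial_transition {Γ : PositiveClosedCurve}
    (hΓ : Γ.PassesInOrder a) [PreconnectedSpace X] (hρ : IsCoveringMap ρ) {x₀ : X}
    (hx₀ : (ρ x₀).1 ∈ Γ.inner) {σ : Fin m → X ≃ₜ X}
    (hσ : ∀ k, IsStandardDeckTransformation Γ ρ x₀ k (σ k))
    {M E : Fin m → Matrix (Fin n) (Fin n) ℂ} (hME : IsAdmissibleData M E) {κ₁ κ₂ : Fin n → ℤ}
    {A₁ A₂ : ℂ → Matrix (Fin n) (Fin n) ℂ}
    (h₁ : IsStandardForm ρ σ M E κ₁ A₁) (h₂ : IsStandardForm ρ σ M E κ₂ A₂) :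
    ∃ V : Matrix (Fin n) (Fin n) (Polynomial ℂ),
      (∀ i j, κ₂ i < κ₁ j → V i j = 0) ∧
      (∀ i j, κ₁ j ≤ κ₂ i → ((V i j).natDegree : ℤ) ≤ κ₂ i - κ₁ j) ∧
      (∀ z, IsUnit (evalMatrix V z)) ∧ CoefficientsRelated a A₁ A₂ V := by
  obtain ⟨Y₁, hY₁⟩ := h₁.apparent
  obtain ⟨Y₂, hY₂⟩ := h₂.apparent
  obtain ⟨f, C, hf, hfY⟩ := h₁.exists_transition hΓ hρ hx₀ hσ h₂ hY₁ hY₂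
  obtain ⟨V, hV0, hVd, hVu, hVf⟩ := exists_evalMatrix_eq
    (fun z hz => ⟨(hf z hz).1, HasEntryDerivAt.analyticAt (hf z hz).2⟩)
    (fun k => h₁.exists_extension hΓ hρ hx₀ hσ h₂ hY₁ hY₂ hfY (hME.nonResonant k))
    (h₁.exists_at_infinity hΓ hρ hx₀ hσ h₂ hY₁ hY₂ hfY)
  refine ⟨V, hV0, hVd, hVu, (coefficientsRelated_iff hVu).2 fun z hz => ?_⟩
  rw [hVf z hz]
  exact (hasEntryDerivAt_evalMatrix V z).unique
    ((hf z hz).2.self_of_nhds.congr (Filter.mem_of_superset ((isOpen_forall_ne a).mem_nhds hz) hVf))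

theorem CoefficientsRelated.solutionsRelated [PreconnectedSpace X] (hρ : IsCoveringMap ρ) {x₀ : X}
    (hx₀ : (ρ x₀).1 ≠ ∞) {A₁ A₂ : ℂ → Matrix (Fin n) (Fin n) ℂ}
    {V : Matrix (Fin n) (Fin n) (Polynomial ℂ)} (hV : ∀ z, IsUnit (evalMatrix V z))
    (h : CoefficientsRelated a A₁ A₂ V) : SolutionsRelated ρ A₁ A₂ V := by
  intro Y₁ Y₂ hY₁ hY₂
  have hg : IsFundamentalSolution A₂ (fun x => (ρ x).1)
      (fun x => evalMatrix V (OnePoint.toComplex (ρ x).1) * Y₁ x) := by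
    refine hY₁.gauge fun x z hz => ⟨hV z, ?_⟩
    filter_upwards [(isOpen_forall_ne a).mem_nhds (ne_of_coe_eq hz)] with w hw
    rw [← (coefficientsRelated_iff hV).1 h w hw]
    exact hasEntryDerivAt_evalMatrix V w
  obtain ⟨z₀, hz₀⟩ := OnePoint.ne_infty_iff_exists.1 hx₀
  have hu : IsUnit ((evalMatrix V (OnePoint.toComplex (ρ x₀).1) * Y₁ x₀)⁻¹ * Y₂ x₀) :=
    (Matrix.isUnit_nonsing_inv_iff.2 (hg x₀ z₀ hz₀.symm).1).mul (hY₂ x₀ z₀ hz₀.symm).1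
  refine ⟨hu.unit, fun x z hx => ?_⟩
  have h3 := hg.exists_eq_mul hρ hY₂ hx₀ (x := x) (by rw [hx]; exact OnePoint.coe_ne_infty z)
  rw [h3, IsUnit.unit_spec, hx, OnePoint.toComplex_coe]

theorem SolutionsRelated.coefficientsRelated (hρ : IsCoveringMap ρ)
    (hsurj : ∀ z : ℂ, (∀ k, z ≠ a k) → ∃ x, (ρ x).1 = (z : OnePoint ℂ))
    {A₁ A₂ : ℂ → Matrix (Fin n) (Fin n) ℂ}
    {V : Matrix (Fin n) (Fin n) (Polynomial ℂ)} (hV : ∀ z, IsUnit (evalMatrix V z))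
    {Y₁ Y₂ : X → Matrix (Fin n) (Fin n) ℂ}
    (hY₁ : IsFundamentalSolution A₁ (fun x => (ρ x).1) Y₁)
    (hY₂ : IsFundamentalSolution A₂ (fun x => (ρ x).1) Y₂)
    (h : SolutionsRelated ρ A₁ A₂ V) : CoefficientsRelated a A₁ A₂ V := by
  obtain ⟨C, hC⟩ := h Y₁ Y₂ hY₁ hY₂
  refine (coefficientsRelated_iff hV).2 fun z hz => ?_
  obtain ⟨x, hx⟩ := hsurj z hz
  obtain ⟨F₁, e1, e2, e3, e4⟩ := hY₁.exists_local hx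
  obtain ⟨F₂, d1, d2, d3, d4⟩ := hY₂.exists_local hx
  have hF : ∀ᶠ w in 𝓝 z, F₂ w = evalMatrix V w * F₁ w * (C : Matrix (Fin n) (Fin n) ℂ) := by
    refine hρ.isOpenMap_val.eventually_nhds_coe hx ?_
    filter_upwards [e1, d1] with x' h1 h2 z' hz'
    rw [← h1 z' hz', ← h2 z' hz', hC x' z' hz']
  have h1 := (((hasEntryDerivAt_evalMatrix V z).mul e4.self_of_nhds).mul_const
    (C : Matrix (Fin n) (Fin n) ℂ)).congr hF
  have h2 := d4.self_of_nhds.unique h1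
  rw [hF.self_of_nhds, ← mul_assoc, ← mul_assoc] at h2
  have h3 := C.isUnit.mul_right_cancel h2
  rw [← mul_assoc, ← add_mul] at h3
  rw [eq_sub_iff_add_eq]
  exact (e3.mul_right_cancel h3).symm

end Main

theorem theorem3p5 {m n : ℕ} (a : Fin m → ℂ)
    (Γ : PositiveClosedCurve) (hΓ : Γ.PassesInOrder a)
    {X : Type*} [TopologicalSpace X] [SimplyConnectedSpace X]
    (ρ : X → PuncturedSphere a) (hρ : IsCoveringMap ρ)
    (x₀ : X) (hx₀ : (ρ x₀).1 ∈ Γ.inner)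
    (σ : Fin m → X ≃ₜ X) (hσ : ∀ k, IsStandardDeckTransformation Γ ρ x₀ k (σ k))
    (M E : Fin m → Matrix (Fin n) (Fin n) ℂ) (hME : IsAdmissibleData M E)
    (κ₁ κ₂ : Fin n → ℤ) (A₁ A₂ : ℂ → Matrix (Fin n) (Fin n) ℂ)
    (h₁ : IsStandardForm ρ σ M E κ₁ A₁) (h₂ : IsStandardForm ρ σ M E κ₂ A₂) :
    κ₁ = κ₂ ∧
    (∃ V : Matrix (Fin n) (Fin n) (Polynomial ℂ),
      IsBlockTriangular κ₁ V ∧ (∀ z, IsUnit (evalMatrix V z)) ∧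
      CoefficientsRelated a A₁ A₂ V ∧ SolutionsRelated ρ A₁ A₂ V) ∧
    (∀ V : Matrix (Fin n) (Fin n) (Polynomial ℂ), IsBlockTriangular κ₁ V →
      (CoefficientsRelated a A₁ A₂ V ↔ SolutionsRelated ρ A₁ A₂ V)) := by
  have hne : (ρ x₀).1 ≠ ∞ := fun h => disjoint_left.1 Γ.disjoint hx₀ (h ▸ Γ.infty_mem)
  -- Stated for arbitrary systems with the same data, so that it applies in both directions.
  have hle : ∀ {κ κ' : Fin n → ℤ} {A A' : ℂ → Matrix (Fin n) (Fin n) ℂ},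
      IsStandardForm ρ σ M E κ A → IsStandardForm ρ σ M E κ' A' → ∀ k, κ k ≤ κ' k := by
    intro κ κ' A A' h h' k
    obtain ⟨V, hV0, -, hVu, -⟩ := h.exists_polynomial_transition hΓ hρ hx₀ hσ hME h'
    refine le_of_isUnit_of_forall_eq_zero h.antitone h'.antitone (hVu 0) (fun i j hij => ?_) k
    change (V i j).eval 0 = 0
    rw [hV0 i j hij, Polynomial.eval_zero]
  obtain rfl : κ₁ = κ₂ := funext fun k => le_antisymm (hle h₁ h₂ k) (hle h₂ h₁ k)
  obtain ⟨Y₁, hY₁⟩ := h₁.apparent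
  obtain ⟨Y₂, hY₂⟩ := h₂.apparent
  refine ⟨rfl, ?_, fun V hV => ⟨fun h => h.solutionsRelated hρ hne hV.isUnit_evalMatrix,
    fun h => h.coefficientsRelated hρ (fun z hz => exists_fiber_point hΓ hρ hx₀ hσ hz)
      hV.isUnit_evalMatrix hY₁ hY₂⟩⟩
  obtain ⟨V, hV0, hVd, hVu, hVc⟩ := h₁.exists_polynomial_transition hΓ hρ hx₀ hσ hME h₂
  exact ⟨V, isBlockTriangular_of_isUnit hV0 hVd (hVu 0), hVu, hVc,
    hVc.solutionsRelated hρ hne hVu⟩
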